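/- Theorem A. Let $d\ge 1$, let $\mathcal X\subset\mathbb R^d$ be measurable and let $\rho$ be a probability distribution on $\mathcal X\times\mathbb R$ with marginal $\rho_X$ on $\mathcal X$ such that $\|X\|_2\le 1$ and $Y\in[-1,1]$ almost surely for $(X,Y)\sim\rho$. Put $g_\rho(x)=\mathbb E[Y\mid X=x]$ and write $\|\cdot\|$ for the norm of $L_2(\rho_X)$. Let $\sigma:\mathbb R\to\mathbb R$ be twice differentiable with $\|\sigma''\|_\infty\le C$ for some $C>0$, $\|\sigma'\|_\infty\le 2$ and $|\sigma(u)|\le 1+|u|$ for all $u$, and let $\gamma\in[0,1]$. Let $\mu_0$ be the uniform distribution on the unit sphere of $\mathbb R^d$. For an even $M$ let $b_1,\dots,b_{M/2}$ be drawn independently from $\mu_0$ and put $b_{r+M/2}=b_r$ for $1\le r\le M/2$. Define the kernels on $\mathcal X$ $$k_\infty(x,x')=\mathbb E_{b\sim\mu_0}[\sigma(b^\top x)\sigma(b^\top x')]+(x^\top x'+\gamma^2)\,\mathbb E_{b\sim\mu_0}[\sigma'(b^\top x)\sigma'(b^\top x')],$$ $$k_M(x,x')=\frac1M\sum_{r=1}^M\sigma(b_r^\top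 x)\sigma(b_r^\top x')+\frac{x^\top x'+\gamma^2}{M}\sum_{r=1}^M\sigma'(b_r^\top x)\sigma'(b_r^\top x'),$$ let $\Sigma_\infty,\Sigma_M$ be the integral operators on $L_2(\rho_X)$ with these kernels, with real powers defined through the eigendecomposition, and let $\mathcal H_M$ be the reproducing kernel Hilbert space of $k_M$. Suppose that there are $r\in[1/2,1]$ and $G\in L_2(\rho_X)$ with $g_\rho=\Sigma_\infty^rG$; write $\Sigma_\infty^{-r}g_\rho=G$. Let $\lambda>0$ and $\delta\in(0,1)$. Then there is $M_0>0$ such that for every even $M\ge M_0$ the following holds with probability at least $1-\delta$ over the choice of $(b_r)$. The functional $g\mapsto\mathbb E_{(X,Y)\sim\rho}[\frac12(g(X)-Y)^2]+\frac\lambda2\|g\|_{\mathcal H_M}^2$ has a unique minimizer $g_{M,\lambda}$ over $\mathcal H_M$, and for all $\eta>0$ with $4(6+\lambda)\eta\le1$ and all integers $T\ge0$, if $(x_t,y_t)_{t\ge0}$ are independent samples from $\rho$ (independent of $(b_r)$), $g^{(0)}=0$, $$g^{(t+1)}=(1-\eta\lambda)g^{(t)}-\eta\,(g^{(t)}(x_t)-y_t)\,k_M(x_t,\cdot),\qquad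 \overline g^{(T)}=\frac1{T+1}\sum_{t=0}^Tg^{(t)},$$ then, with the expectation over the samples, $$\mathbb E\,\|\overline g^{(T)}-g_{M,\lambda}\|^2\le\frac{4}{\eta^2(T+1)^2}\|(\Sigma_M+\lambda I)^{-1}g_{M,\lambda}\|^2+\frac{2\cdot24^2}{T+1}\|(\Sigma_M+\lambda I)^{-1/2}g_{M,\lambda}\|^2+\frac{8}{T+1}\left(1+\|g_\rho\|^2+24\|\Sigma_\infty^{-r}g_\rho\|^2\right)\mathrm{tr}\left(\Sigma_M(\Sigma_M+\lambda I)^{-1}\right).$$ -/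

import Mathlib

open MeasureTheory Set
open scoped ENNReal InnerProductSpace

namespace NTK

noncomputable section

/-! ### Operators on a real Hilbert space -/

section Operators

variable {F : Type*} [NormedAddCommGroup F] [InnerProductSpace ℝ F] [CompleteSpace F]

/-- The eigenspace `{f | A f = ν f}` of a bounded operator. -/
def eigSpace (A : F →L[ℝ] F) (ν : ℝ) : Submodule ℝ F :=
  (A - ν • ContinuousLinearMap.id ℝ F).ker

instance (A : F →L[ℝ] F) (ν : ℝ) : (eigSpace A ν).HasOrthogonalProjection := by
  unfold eigSpace
  infer_instance

/-- The real power `A ^ s` of a positive self-adjoint operator with an orthonormal basis of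
eigenvectors, applied to `f`: the sum over the eigenvalues `ν` of `ν ^ s` times the orthogonal
projection of `f` to the eigenspace of `ν`.  (Grouping the terms `λᵢ ^ s ⟪f, φᵢ⟫ φᵢ` of an
eigendecomposition by eigenvalue makes the choice of the `φᵢ` irrelevant; a real number `ν` which
is not an eigenvalue contributes `0`.) -/
def opPow (A : F →L[ℝ] F) (s : ℝ) (f : F) : F :=
  ∑' ν : ℝ, ν ^ s • (eigSpace A ν).starProjection f

/-- The resolvent `(A + lam I)⁻¹`. -/
def resolvent (A : F →L[ℝ] F) (lam : ℝ) : F →L[ℝ] F :=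
  Ring.inverse (A + lam • (1 : F →L[ℝ] F))

/-- The trace `∑ᵢ ⟪eᵢ, A eᵢ⟫` over an orthonormal basis `(eᵢ)`
(for a positive operator it does not depend on the basis). -/
def trace (A : F →L[ℝ] F) : ℝ :=
  ∑' e : (exists_hilbertBasis ℝ F).choose, ⟪(e : F), A (e : F)⟫_ℝ

end Operators

/-! ### Integral operators on `L²(μ)` -/

section IntegralOperator

variable {X : Type*} [MeasurableSpace X] {μ : Measure X}

theorem aestronglyMeasurable_integral_kernel [SFinite μ] {k : X → X → ℝ}
    (hk : MemLp (Function.uncurry k) 2 (μ.prod μ)) {f : X → ℝ} (hf : MemLp f 2 μ) :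
    AEStronglyMeasurable (fun x => ∫ y, k x y * f y ∂μ) μ :=
  (hk.1.mul hf.1.comp_snd).integral_prod_right'

theorem ae_memLp_section [SFinite μ] {k : X → X → ℝ}
    (hk : MemLp (Function.uncurry k) 2 (μ.prod μ)) : ∀ᵐ x ∂μ, MemLp (k x) 2 μ := by
  have h1 : ∀ᵐ x ∂μ, AEStronglyMeasurable (k x) μ := hk.1.prodMk_left
  have h2 : Integrable (fun p : X × X => k p.1 p.2 ^ 2) (μ.prod μ) := hk.integrable_sq
  filter_upwards [h1, h2.prod_right_ae] with x hx hx2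
  exact (memLp_two_iff_integrable_sq hx).2 hx2

theorem eLpNorm_integral_kernel_le [SFinite μ] {k : X → X → ℝ}
    (hk : MemLp (Function.uncurry k) 2 (μ.prod μ)) {f : X → ℝ} (hf : MemLp f 2 μ) :
    eLpNorm (fun x => ∫ y, k x y * f y ∂μ) 2 μ
      ≤ eLpNorm (Function.uncurry k) 2 (μ.prod μ) * eLpNorm f 2 μ := by
  have sq : ∀ {Y : Type _} [MeasurableSpace Y] (ν : Measure Y) (g : Y → ℝ),
      eLpNorm g 2 ν ^ (2 : ℝ) = ∫⁻ y, ‖g y‖ₑ ^ (2 : ℝ) ∂ν := by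
    intro Y _ ν g
    have := eLpNorm_nnreal_pow_eq_lintegral (μ := ν) (f := g) (p := 2) (by norm_num)
    simpa using this
  rw [← ENNReal.rpow_le_rpow_iff (z := 2) (by norm_num),
    ENNReal.mul_rpow_of_nonneg _ _ (by norm_num), sq μ, sq (μ.prod μ)]
  have hm : AEMeasurable (fun p : X × X => ‖Function.uncurry k p‖ₑ ^ (2 : ℝ)) (μ.prod μ) :=
    hk.1.enorm.pow_const _
  rw [lintegral_prod _ hm]
  have hfin : eLpNorm f 2 μ ^ (2 : ℝ) ≠ ∞ :=
    ENNReal.rpow_ne_top_of_nonneg (by norm_num) hf.2.ne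
  rw [← lintegral_mul_const' _ _ hfin]
  refine lintegral_mono_ae ?_
  filter_upwards [ae_memLp_section hk] with x hx
  have hsec : eLpNorm (k x) 2 μ ^ (2 : ℝ) = ∫⁻ y, ‖Function.uncurry k (x, y)‖ₑ ^ (2 : ℝ) ∂μ :=
    sq μ (k x)
  rw [← hsec, ← ENNReal.mul_rpow_of_nonneg _ _ (by norm_num)]
  refine ENNReal.rpow_le_rpow ?_ (by norm_num)
  calc ‖∫ y, k x y * f y ∂μ‖ₑ ≤ ∫⁻ y, ‖k x y * f y‖ₑ ∂μ := enorm_integral_le_lintegral_enorm _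
    _ = eLpNorm (k x • f) 1 μ := by
        rw [eLpNorm_one_eq_lintegral_enorm]
        rfl
    _ ≤ eLpNorm (k x) 2 μ * eLpNorm f 2 μ := eLpNorm_smul_le_mul_eLpNorm hf.1 hx.1

theorem memLp_integral_kernel [SFinite μ] {k : X → X → ℝ}
    (hk : MemLp (Function.uncurry k) 2 (μ.prod μ)) {f : X → ℝ} (hf : MemLp f 2 μ) :
    MemLp (fun x => ∫ y, k x y * f y ∂μ) 2 μ :=
  ⟨aestronglyMeasurable_integral_kernel hk hf,
    (eLpNorm_integral_kernel_le hk hf).trans_lt (ENNReal.mul_lt_top hk.2 hf.2)⟩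

theorem integrable_kernel_mul {k : X → X → ℝ} {f : X → ℝ} (hf : MemLp f 2 μ) {x : X}
    (hx : MemLp (k x) 2 μ) : Integrable (fun y => k x y * f y) μ :=
  hx.integrable_mul hf

/-- The integral operator `f ↦ ∫ y, k(·, y) f(y) dμ(y)` on `L²(μ)` of a square-integrable
kernel. -/
def integralOpOfMemLp [SFinite μ] (k : X → X → ℝ)
    (hk : MemLp (Function.uncurry k) 2 (μ.prod μ)) : Lp ℝ 2 μ →L[ℝ] Lp ℝ 2 μ :=
  LinearMap.mkContinuous
    { toFun := fun f => (memLp_integral_kernel hk (Lp.memLp f)).toLp _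
      map_add' := by
        intro f g
        rw [← MemLp.toLp_add]
        refine MemLp.toLp_congr _ _ ?_
        filter_upwards [ae_memLp_section hk] with x hx
        rw [Pi.add_apply, ← integral_add (integrable_kernel_mul (Lp.memLp f) hx)
          (integrable_kernel_mul (Lp.memLp g) hx)]
        refine integral_congr_ae ?_
        filter_upwards [Lp.coeFn_add f g] with y hy
        rw [hy, Pi.add_apply, mul_add]
      map_smul' := by
        intro c f
        rw [RingHom.id_apply, ← MemLp.toLp_const_smul]
        refine MemLp.toLp_congr _ _ ?_
        filter_upwards with x
        rw [Pi.smul_apply, smul_eq_mul, ← integral_const_mul]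
        refine integral_congr_ae ?_
        filter_upwards [Lp.coeFn_smul c f] with y hy
        rw [hy, Pi.smul_apply, smul_eq_mul]
        ring }
    (eLpNorm (Function.uncurry k) 2 (μ.prod μ)).toReal
    (by
      intro f
      have hf := memLp_integral_kernel hk (Lp.memLp f)
      have hn : ‖hf.toLp (fun x => ∫ y, k x y * f y ∂μ)‖ =
          (eLpNorm (fun x => ∫ y, k x y * f y ∂μ) 2 μ).toReal := Lp.norm_toLp _ hf
      refine hn.le.trans ?_
      rw [Lp.norm_def, ← ENNReal.toReal_mul]
      exact ENNReal.toReal_mono (ENNReal.mul_lt_top hk.2 (Lp.memLp f).2).ne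
        (eLpNorm_integral_kernel_le hk (Lp.memLp f)))

theorem integralOpOfMemLp_apply [SFinite μ] (k : X → X → ℝ)
    (hk : MemLp (Function.uncurry k) 2 (μ.prod μ)) (f : Lp ℝ 2 μ) :
    integralOpOfMemLp k hk f =ᵐ[μ] fun x => ∫ y, k x y * f y ∂μ :=
  (memLp_integral_kernel hk (Lp.memLp f)).coeFn_toLp

open Classical in
/-- The integral operator on `L²(μ)` with kernel `k` (every measurable kernel which is bounded
almost everywhere is square-integrable for a probability measure; the value `0` is never used for
such kernels). -/
def integralOp (μ : Measure X) [SFinite μ] (k : X → X → ℝ) : Lp ℝ 2 μ →L[ℝ] Lp ℝ 2 μ :=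
  if hk : MemLp (Function.uncurry k) 2 (μ.prod μ) then integralOpOfMemLp k hk else 0

open Classical in
/-- The class in `L²(μ)` of a square-integrable function. -/
def toL2 (μ : Measure X) (f : X → ℝ) : Lp ℝ 2 μ :=
  if hf : MemLp f 2 μ then hf.toLp f else 0

end IntegralOperator

/-! ### The data distribution -/

section Data

variable {X : Type*} [MeasurableSpace X]

/-- The Bayes rule `x ↦ 𝔼[Y | X = x]`. -/
def bayes (ρ : Measure (X × ℝ)) [IsFiniteMeasure ρ] (x : X) : ℝ :=
  ∫ y, y ∂(ρ.condKernel x)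

/-- The expected risk of the squared loss `ℓ(z, y) = (z - y)² / 2`. -/
def risk (ρ : Measure (X × ℝ)) (g : X → ℝ) : ℝ :=
  ∫ p, (1 / 2) * (g p.1 - p.2) ^ 2 ∂ρ

end Data

/-! ### The neural tangent kernel and its random feature approximation -/

section Kernels

variable {d : ℕ}

/-- The uniform distribution on the unit sphere of `ℝᵈ` (`d ≥ 1`). -/
def unifSphere (d : ℕ) : Measure (Metric.sphere (0 : EuclideanSpace ℝ (Fin d)) 1) :=
  ((volume : Measure (EuclideanSpace ℝ (Fin d))).toSphere univ)⁻¹ •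
    (volume : Measure (EuclideanSpace ℝ (Fin d))).toSphere

/-- The neural tangent kernel of infinite width, with output weights `±1` at initialization. -/
def kInf (σ : ℝ → ℝ) (γ : ℝ) (x x' : EuclideanSpace ℝ (Fin d)) : ℝ :=
  (∫ b, σ ⟪(b : EuclideanSpace ℝ (Fin d)), x⟫_ℝ * σ ⟪(b : EuclideanSpace ℝ (Fin d)), x'⟫_ℝ
      ∂(unifSphere d)) +
    (⟪x, x'⟫_ℝ + γ ^ 2) *
      ∫ b, deriv σ ⟪(b : EuclideanSpace ℝ (Fin d)), x⟫_ℝ *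
        deriv σ ⟪(b : EuclideanSpace ℝ (Fin d)), x'⟫_ℝ ∂(unifSphere d)

/-- The neural tangent kernel of width `M` with input weights `B = (b₁, …, b_M)`. -/
def kFin (σ : ℝ → ℝ) (γ : ℝ) {M : ℕ} (B : Fin M → EuclideanSpace ℝ (Fin d))
    (x x' : EuclideanSpace ℝ (Fin d)) : ℝ :=
  1 / (M : ℝ) * ∑ r, σ ⟪B r, x⟫_ℝ * σ ⟪B r, x'⟫_ℝ +
    (⟪x, x'⟫_ℝ + γ ^ 2) / (M : ℝ) * ∑ r, deriv σ ⟪B r, x⟫_ℝ * deriv σ ⟪B r, x'⟫_ℝ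

/-- The symmetric initialization of the input weights: the second half of the `m + m` weights
repeats the first half. -/
def symInit {m : ℕ} (w : Fin m → Metric.sphere (0 : EuclideanSpace ℝ (Fin d)) 1) :
    Fin (m + m) → EuclideanSpace ℝ (Fin d) :=
  Fin.append (fun r => (w r : EuclideanSpace ℝ (Fin d))) (fun r => (w r : EuclideanSpace ℝ (Fin d)))

/-- A real kernel on a set, as a matrix of operators on `ℝ`. -/
def kernelMatrix {X : Type*} (k : X → X → ℝ) : Matrix X X (ℝ →L[ℝ] ℝ) :=
  Matrix.of fun x x' => k x x' • (1 : ℝ →L[ℝ] ℝ)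

theorem kFin_quadratic_nonneg (σ : ℝ → ℝ) (γ : ℝ) {M : ℕ}
    (B : Fin M → EuclideanSpace ℝ (Fin d)) {ι : Type*} (s : Finset ι) (v : ι → ℝ)
    (x : ι → EuclideanSpace ℝ (Fin d)) :
    0 ≤ ∑ i ∈ s, ∑ j ∈ s, v i * v j * kFin σ γ B (x i) (x j) := by
  have key : ∑ i ∈ s, ∑ j ∈ s, v i * v j * kFin σ γ B (x i) (x j) =
      1 / (M : ℝ) * ∑ r, ((∑ i ∈ s, v i * σ ⟪B r, x i⟫_ℝ) ^ 2 +
        (‖∑ i ∈ s, (v i * deriv σ ⟪B r, x i⟫_ℝ) • x i‖ ^ 2 +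
          γ ^ 2 * (∑ i ∈ s, v i * deriv σ ⟪B r, x i⟫_ℝ) ^ 2)) := by
    have hr : ∀ r, (∑ i ∈ s, v i * σ ⟪B r, x i⟫_ℝ) ^ 2 +
        (‖∑ i ∈ s, (v i * deriv σ ⟪B r, x i⟫_ℝ) • x i‖ ^ 2 +
          γ ^ 2 * (∑ i ∈ s, v i * deriv σ ⟪B r, x i⟫_ℝ) ^ 2) =
        ∑ i ∈ s, ∑ j ∈ s, v i * v j * (σ ⟪B r, x i⟫_ℝ * σ ⟪B r, x j⟫_ℝ +
          (⟪x i, x j⟫_ℝ + γ ^ 2) * (deriv σ ⟪B r, x i⟫_ℝ * deriv σ ⟪B r, x j⟫_ℝ)) := by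
      intro r
      rw [← real_inner_self_eq_norm_sq, sum_inner, pow_two (∑ i ∈ s, _),
        pow_two (∑ i ∈ s, _), Finset.sum_mul_sum, Finset.sum_mul_sum]
      simp only [inner_sum, real_inner_smul_left, real_inner_smul_right, Finset.mul_sum,
        ← Finset.sum_add_distrib]
      refine Finset.sum_congr rfl fun i _ => Finset.sum_congr rfl fun j _ => ?_
      ring
    simp only [hr]
    rw [Finset.sum_comm, Finset.mul_sum]
    simp only [Finset.sum_comm (s := Finset.univ), Finset.mul_sum, kFin]
    rw [Finset.sum_comm]
    refine Finset.sum_congr rfl fun i _ => Finset.sum_congr rfl fun j _ => ?_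
    rw [← Finset.sum_add_distrib, Finset.mul_sum]
    refine Finset.sum_congr rfl fun r _ => ?_
    ring
  rw [key]
  positivity


theorem posSemidef_kernelMatrix_kFin (σ : ℝ → ℝ) (γ : ℝ) {M : ℕ}
    (B : Fin M → EuclideanSpace ℝ (Fin d)) (X : Set (EuclideanSpace ℝ (Fin d))) :
    (kernelMatrix fun x x' : X => kFin σ γ B x x').PosSemidef := by
  have tf := RKHS.posSemidef_tfae (𝕜 := ℝ) (K := kernelMatrix fun x x' : X => kFin σ γ B x x')
  have tf2 := tf.out 0 2
  refine tf2.2 ⟨?_, fun v => ?_⟩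
  · ext x x'
    simp [kernelMatrix, kFin, real_inner_comm, mul_comm, Matrix.conjTranspose_apply]
  · have h := kFin_quadratic_nonneg σ γ B v.support v (fun x : X => (x : EuclideanSpace ℝ (Fin d)))
    simp only [Finsupp.sum]
    refine h.trans_eq ?_
    simp only [kernelMatrix, Matrix.of_apply, smul_apply,
      one_apply_eq_self, smul_eq_mul, RCLike.inner_apply, conj_trivial, RCLike.re_to_real]
    rw [Finset.sum_comm]
    refine Finset.sum_congr rfl fun i _ => Finset.sum_congr rfl fun j _ => ?_
    ring

instance (σ : ℝ → ℝ) (γ : ℝ) {M : ℕ} (B : Fin M → EuclideanSpace ℝ (Fin d))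
    (X : Set (EuclideanSpace ℝ (Fin d))) :
    Fact (kernelMatrix fun x x' : X => kFin σ γ B x x').PosSemidef :=
  ⟨posSemidef_kernelMatrix_kFin σ γ B X⟩

/-- The reproducing kernel Hilbert space of functions on `X` with kernel `kFin σ γ B`. -/
abbrev HM (σ : ℝ → ℝ) (γ : ℝ) {M : ℕ} (B : Fin M → EuclideanSpace ℝ (Fin d))
    (X : Set (EuclideanSpace ℝ (Fin d))) :=
  RKHS.OfKernel (kernelMatrix fun x x' : X => kFin σ γ B x x')

/-- The integral operator `Σ_∞` on `L²(μ)` of the infinite-width kernel, restricted to `X`. -/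
def sigmaInf (σ : ℝ → ℝ) (γ : ℝ) {X : Set (EuclideanSpace ℝ (Fin d))} (μ : Measure X)
    [SFinite μ] : Lp ℝ 2 μ →L[ℝ] Lp ℝ 2 μ :=
  integralOp μ fun x x' : X =>
    kInf σ γ (x : EuclideanSpace ℝ (Fin d)) (x' : EuclideanSpace ℝ (Fin d))

/-- The integral operator `Σ_M` on `L²(μ)` of the kernel of width `M`, restricted to `X`. -/
def sigmaM (σ : ℝ → ℝ) (γ : ℝ) {M : ℕ} (B : Fin M → EuclideanSpace ℝ (Fin d))
    {X : Set (EuclideanSpace ℝ (Fin d))} (μ : Measure X) [SFinite μ] :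
    Lp ℝ 2 μ →L[ℝ] Lp ℝ 2 μ :=
  integralOp μ fun x x' : X => kFin σ γ B x x'

end Kernels

/-! ### Averaged stochastic gradient descent in a reproducing kernel Hilbert space -/

section SGD

variable {X : Type*} {H : Type*} [NormedAddCommGroup H] [InnerProductSpace ℝ H] [RKHS ℝ H X ℝ]

/-- The iterates `g⁽⁰⁾ = 0`,
`g⁽ᵗ⁺¹⁾ = (1 - η lam) g⁽ᵗ⁾ - η (g⁽ᵗ⁾(xₜ) - yₜ) k(xₜ, ·)` for samples `z t = (xₜ, yₜ)`. -/
def refSGD (H : Type*) [NormedAddCommGroup H] [InnerProductSpace ℝ H] [CompleteSpace H]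
    [RKHS ℝ H X ℝ] (η lam : ℝ) (z : ℕ → X × ℝ) : ℕ → H
  | 0 => 0
  | t + 1 => (1 - η * lam) • refSGD H η lam z t -
      η • ((refSGD H η lam z t (z t).1 - (z t).2) • RKHS.kerFun H (z t).1 (1 : ℝ))

/-- The uniform average of the iterates `g⁽⁰⁾, …, g⁽ᵀ⁾`. -/
def refASGD (H : Type*) [NormedAddCommGroup H] [InnerProductSpace ℝ H] [CompleteSpace H]
    [RKHS ℝ H X ℝ] (η lam : ℝ) (z : ℕ → X × ℝ) (T : ℕ) : H :=
  (1 / ((T : ℝ) + 1)) • ∑ t ∈ Finset.range (T + 1), refSGD H η lam z t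

/-- The regularized expected risk. -/
def regRisk [MeasurableSpace X] (ρ : Measure (X × ℝ)) (lam : ℝ) (g : H) : ℝ :=
  risk ρ g + lam / 2 * ‖g‖ ^ 2

end SGD

end

end NTK

/-!
The kernel `k_M` has an explicit finite-dimensional feature map `Φ` (the gradient features of the
network), so everything happens in a Euclidean space `E`. Let `J : E → L²(ρ_X)` map `v` to the
function `⟪Φ(·), v⟫`. Then `Σ_M = J J*`, the covariance of the features is `T = J* J`, elements of
`H_M` are the functions `⟪Φ(·), θ⟫`, the minimizer of the regularized risk is represented by the
solution `θ*` of `(T + lam) θ* = J* g_ρ`, and stochastic gradient descent in `H_M` is regularized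
least-mean-squares in `E`.

*Averaged iterates* (`LMSData.integral_average_le`). The errors satisfy
`e (t+1) = (1 - η A) e t + η ζ t` with `A = T + lam`, where `ζ t` is centred given the past.
Summing in an eigenbasis of `T` gives `η A ∑ e t = -(1 - q ^ n) θ* + η ∑ (1 - q ^ (n-1-s)) ζ s`
with `q = 1 - η A`. The noises are orthogonal, so only their covariances matter, and the bias is
`‖(Σ_M + lam)⁻¹ g‖² / (η n)²`. To bound the covariance of `ζ t`, write the iterate as its mean
plus a deviation. The mean iterates are those of gradient descent, and have norm at most `‖θ*‖`;
the covariance of the deviation is at most `η S`, where `S` is a bound for the squared residuals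
of the mean iterates (`LMSData.integral_dev_sq_le`), because for `η (12 + lam) ≤ 1/2` one step
contracts by more than the noise adds. Hence `ζ t` has covariance at most `(3/2) S T`, and the
variance term is `(3/2) S / n` times `tr (Σ_M (Σ_M + lam)⁻¹)`, with `S = 2 (1 + 12 ‖θ*‖²)`.
The term with `(Σ_M + lam)^(-1/2)` in the theorem is not needed for this bound.

*Norm of the minimizer* (`exists_event_norm_sq_normal_eq_le`). Put `f = (Σ_∞ + lam)⁻¹ g_ρ`.
Comparing `θ*` with the competitor `J* f` gives `‖θ*‖² ≤ ⟪f, g_ρ⟫ + o(1)` as soon as `Σ_M f` is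
close to `Σ_∞ f`. This holds with high probability for large `M`, because the mean square error
of a Monte Carlo average decays like `1 / M` (`exists_integral_norm_sq_emp_sub_mean_le`). By the
source condition, `⟪f, g_ρ⟫ = ∑ ν ^ (2 r) / (ν + lam) ‖P_ν G‖²`, where `P_ν` projects to an
eigenspace of `Σ_∞`, and this is at most `‖g_ρ‖² / 9 + 9 ‖G‖² / 4` (`inner_le_of_opPow`).
-/

set_option linter.unusedSectionVars false

namespace NTK

noncomputable section


/-! ### Bounded measurable maps -/

section BddMeas

variable {Ω : Type*} [MeasurableSpace Ω] {E : Type*} [NormedAddCommGroup E] [MeasurableSpace E]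

/-- A measurable map with values in a normed group which is bounded everywhere. -/
def BddMeas (f : Ω → E) : Prop := Measurable f ∧ ∃ C : ℝ, ∀ z, ‖f z‖ ≤ C

theorem bddMeas_const (c : E) : BddMeas (fun _ : Ω => c) :=
  ⟨measurable_const, ‖c‖, fun _ => le_rfl⟩

theorem BddMeas.comp {Ω' : Type*} [MeasurableSpace Ω'] {f : Ω → E} (hf : BddMeas f)
    {g : Ω' → Ω} (hg : Measurable g) : BddMeas (fun z => f (g z)) :=
  ⟨hf.1.comp hg, hf.2.imp fun _ h z => h (g z)⟩

theorem BddMeas.add [BorelSpace E] [SecondCountableTopology E] {f g : Ω → E} (hf : BddMeas f)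
    (hg : BddMeas g) : BddMeas (fun z => f z + g z) := by
  obtain ⟨hf, C, hC⟩ := hf
  obtain ⟨hg, D, hD⟩ := hg
  exact ⟨hf.add hg, C + D, fun z => (norm_add_le _ _).trans (add_le_add (hC z) (hD z))⟩

theorem BddMeas.sub [BorelSpace E] [SecondCountableTopology E] {f g : Ω → E} (hf : BddMeas f)
    (hg : BddMeas g) : BddMeas (fun z => f z - g z) := by
  obtain ⟨hf, C, hC⟩ := hf
  obtain ⟨hg, D, hD⟩ := hg
  exact ⟨hf.sub hg, C + D, fun z => (norm_sub_le _ _).trans (add_le_add (hC z) (hD z))⟩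

theorem BddMeas.smul [NormedSpace ℝ E] [BorelSpace E] [SecondCountableTopology E] {c : Ω → ℝ}
    {f : Ω → E} (hc : BddMeas c) (hf : BddMeas f) : BddMeas (fun z => c z • f z) := by
  obtain ⟨hf, C, hC⟩ := hf
  obtain ⟨hc, D, hD⟩ := hc
  refine ⟨hc.smul hf, D * C, fun z => ?_⟩
  rw [norm_smul]
  exact mul_le_mul (hD z) (hC z) (norm_nonneg _) ((norm_nonneg _).trans (hD z))

theorem BddMeas.mul {f g : Ω → ℝ} (hf : BddMeas f) (hg : BddMeas g) :
    BddMeas (fun z => f z * g z) := hf.smul hg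

theorem BddMeas.sq {f : Ω → ℝ} (hf : BddMeas f) : BddMeas (fun z => f z ^ 2) := by
  simpa only [pow_two] using hf.mul hf

theorem BddMeas.inner [InnerProductSpace ℝ E] [BorelSpace E] [SecondCountableTopology E]
    {f g : Ω → E} (hf : BddMeas f) (hg : BddMeas g) : BddMeas (fun z => ⟪f z, g z⟫_ℝ) := by
  obtain ⟨hf, C, hC⟩ := hf
  obtain ⟨hg, D, hD⟩ := hg
  refine ⟨hf.inner hg, C * D, fun z => (norm_inner_le_norm _ _).trans ?_⟩
  exact mul_le_mul (hC z) (hD z) (norm_nonneg _) ((norm_nonneg _).trans (hC z))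

theorem BddMeas.clm [NormedSpace ℝ E] [BorelSpace E] {f : Ω → E} (hf : BddMeas f)
    (A : E →L[ℝ] E) : BddMeas (fun z => A (f z)) := by
  obtain ⟨hf, C, hC⟩ := hf
  refine ⟨A.continuous.measurable.comp hf, ‖A‖ * C, fun z => (A.le_opNorm _).trans ?_⟩
  exact mul_le_mul_of_nonneg_left (hC z) (norm_nonneg _)

theorem BddMeas.sum [BorelSpace E] [SecondCountableTopology E] {ι : Type*} (s : Finset ι)
    {f : ι → Ω → E} (hf : ∀ i ∈ s, BddMeas (f i)) : BddMeas (fun z => ∑ i ∈ s, f i z) := by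
  classical
  induction s using Finset.induction_on with
  | empty => simpa using bddMeas_const (0 : E)
  | insert a s ha ih =>
    simp only [Finset.sum_insert ha]
    exact (hf a (by simp)).add (ih fun i hi => hf i (by simp [hi]))

theorem BddMeas.integrable [BorelSpace E] [SecondCountableTopology E] {f : Ω → E}
    (hf : BddMeas f) (μ : Measure Ω) [IsFiniteMeasure μ] : Integrable f μ := by
  obtain ⟨hf, C, hC⟩ := hf
  exact Integrable.of_bound hf.aestronglyMeasurable C (Filter.Eventually.of_forall hC)

theorem BddMeas.integral_add_mul_sq {X Y : Ω → ℝ} (hX : BddMeas X) (hY : BddMeas Y)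
    (μ : Measure Ω) [IsFiniteMeasure μ] (a : ℝ) :
    ∫ z, (X z + a * Y z) ^ 2 ∂μ =
      ∫ z, X z ^ 2 ∂μ + 2 * a * ∫ z, X z * Y z ∂μ + a ^ 2 * ∫ z, Y z ^ 2 ∂μ := by
  have h : (fun z => (X z + a * Y z) ^ 2) =
      ((fun z => X z ^ 2) + fun z => 2 * a * (X z * Y z)) + fun z => a ^ 2 * Y z ^ 2 := by
    ext z
    simp only [Pi.add_apply]
    ring
  have i1 := hX.sq.integrable μ
  have i2 := ((hX.mul hY).integrable μ).const_mul (2 * a)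
  rw [h, integral_add' (i1.add i2) ((hY.sq.integrable μ).const_mul _), integral_add' i1 i2,
    integral_const_mul, integral_const_mul]

end BddMeas

/-! ### Resampling one coordinate of an i.i.d. sequence -/

section Resampling

variable {Z : Type*} [MeasurableSpace Z] (ρ : Measure Z) [IsProbabilityMeasure ρ]

/-- Replacing one entry of an i.i.d. sequence by an independent copy does not change the law. -/
theorem measurePreserving_update_infinitePi (t : ℕ) :
    MeasurePreserving (fun p : (ℕ → Z) × Z => Function.update p.1 t p.2)
      ((Measure.infinitePi fun _ : ℕ => ρ).prod ρ) (Measure.infinitePi fun _ : ℕ => ρ) := by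
  classical
  have hm : Measurable (fun p : (ℕ → Z) × Z => Function.update p.1 t p.2) := measurable_update'
  refine ⟨hm, Measure.eq_infinitePi _ fun s S hS => ?_⟩
  have hpre : (fun p : (ℕ → Z) × Z => Function.update p.1 t p.2) ⁻¹' (Set.pi s S) =
      (Set.pi (s.erase t : Finset ℕ) S) ×ˢ (if t ∈ s then S t else univ) := by
    ext ⟨z, a⟩
    simp only [mem_preimage, Set.mem_pi, mem_prod, Finset.mem_coe, Finset.mem_erase]
    constructor
    · intro h
      refine ⟨fun i hi => by simpa [Function.update_of_ne hi.1] using h i hi.2, ?_⟩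
      split_ifs with ht
      · simpa using h t ht
      · trivial
    · rintro ⟨h1, h2⟩ i hi
      by_cases hit : i = t
      · subst hit
        simpa [hi] using h2
      · simpa [Function.update_of_ne hit] using h1 i ⟨hit, hi⟩
  rw [Measure.map_apply hm (MeasurableSet.pi s.countable_toSet fun i _ => hS i), hpre,
    Measure.prod_prod, Measure.infinitePi_pi _ fun i _ => hS i]
  split_ifs with ht
  · exact Finset.prod_erase_mul s _ ht
  · rw [Finset.erase_eq_of_notMem ht, measure_univ, mul_one]

/-- The `t`-th entry of an i.i.d. sequence is independent of anything which does not look at it: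
it can be integrated out first. -/
theorem integral_infinitePi_eval (t : ℕ) {f : (ℕ → Z) → Z → ℝ}
    (hf : BddMeas (Function.uncurry f)) (hinv : ∀ z a b, f (Function.update z t a) b = f z b) :
    ∫ z, f z (z t) ∂(Measure.infinitePi fun _ : ℕ => ρ) =
      ∫ z, ∫ b, f z b ∂ρ ∂(Measure.infinitePi fun _ : ℕ => ρ) := by
  have hP := measurePreserving_update_infinitePi ρ t
  have hg : BddMeas (fun z : ℕ → Z => f z (z t)) :=
    hf.comp (measurable_id.prodMk (measurable_pi_apply t))
  have h1 := integral_map hP.measurable.aemeasurable (hg.1.aestronglyMeasurable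
    (μ := Measure.map (fun p : (ℕ → Z) × Z => Function.update p.1 t p.2)
      ((Measure.infinitePi fun _ : ℕ => ρ).prod ρ)))
  rw [hP.map_eq] at h1
  rw [h1]
  simp only [hinv, Function.update_self]
  exact integral_prod _ (hf.integrable _)

end Resampling


/-! ### Regularized least-mean-squares in a finite-dimensional feature space -/

section LeastMeanSquares

variable {Z : Type*} [MeasurableSpace Z] {E : Type*} [NormedAddCommGroup E]
  [InnerProductSpace ℝ E] [FiniteDimensional ℝ E] [MeasurableSpace E] [BorelSpace E]

/-- The iterates of regularized stochastic gradient descent for the squared loss in the feature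
space, for the feature map `Φ` and the labels `y` of the samples `z 0, z 1, …`. -/
def lms (Φ : Z → E) (y : Z → ℝ) (η lam : ℝ) (z : ℕ → Z) : ℕ → E
  | 0 => 0
  | t + 1 => (1 - η * lam) • lms Φ y η lam z t -
      η • ((⟪Φ (z t), lms Φ y η lam z t⟫_ℝ - y (z t)) • Φ (z t))

/-- The iterates of gradient descent on the regularized risk with covariance `T` and minimizer
`th`. -/
def meanIter (T : E →L[ℝ] E) (th : E) (η lam : ℝ) : ℕ → E
  | 0 => 0
  | t + 1 => meanIter T th η lam t -
      η • (T (meanIter T th η lam t - th) + lam • (meanIter T th η lam t - th))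

/-- The difference, at `θ`, between the gradient of the regularized risk with covariance `T` and
minimizer `th` and the stochastic gradient at the sample `z` (the regularization of `θ` itself
cancels). -/
def gradNoise (Φ : Z → E) (y : Z → ℝ) (T : E →L[ℝ] E) (th : E) (lam : ℝ) (θ : E) (z : Z) : E :=
  T (θ - th) - lam • th - (⟪Φ z, θ⟫_ℝ - y z) • Φ z

/-- Bounded features `Φ` and labels `y` with covariance operator `T`, such that `th` is the
minimizer of the regularized risk, together with the condition on the step size `η`. -/
structure LMSData (ρ : Measure Z) (Φ : Z → E) (y : Z → ℝ) (T : E →L[ℝ] E) (th : E)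
    (lam η R : ℝ) : Prop where
  meas_feature : Measurable Φ
  norm_feature : ∀ z, ‖Φ z‖ ^ 2 ≤ R
  meas_label : Measurable y
  abs_label : ∀ z, |y z| ≤ 1
  cov : ∀ v w, ⟪v, T w⟫_ℝ = ∫ z, ⟪Φ z, v⟫_ℝ * ⟪Φ z, w⟫_ℝ ∂ρ
  normal_eq : ∀ v, ∫ z, y z * ⟪Φ z, v⟫_ℝ ∂ρ = ⟪v, T th + lam • th⟫_ℝ
  lam_pos : 0 < lam
  step_pos : 0 < η
  step_le : η * (R + lam) ≤ 1 / 2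

theorem lms_update (Φ : Z → E) (y : Z → ℝ) (η lam : ℝ) (z : ℕ → Z) {s t : ℕ} (hst : s ≤ t)
    (a : Z) : lms Φ y η lam (Function.update z t a) s = lms Φ y η lam z s := by
  induction s with
  | zero => rfl
  | succ s ih =>
    simp only [lms, ih (by omega), Function.update_of_ne (show s ≠ t by omega)]

namespace LMSData

variable {ρ : Measure Z} {Φ : Z → E} {y : Z → ℝ} {T : E →L[ℝ] E} {th : E} {lam η R : ℝ}

theorem bddMeas_feature (h : LMSData ρ Φ y T th lam η R) : BddMeas Φ :=
  ⟨h.meas_feature, √R, fun z => Real.le_sqrt_of_sq_le (h.norm_feature z)⟩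

theorem bddMeas_label (h : LMSData ρ Φ y T th lam η R) : BddMeas y :=
  ⟨h.meas_label, 1, h.abs_label⟩

theorem bddMeas_inner_feature (h : LMSData ρ Φ y T th lam η R) (v : E) :
    BddMeas (fun z => ⟪Φ z, v⟫_ℝ) := h.bddMeas_feature.inner (bddMeas_const v)

theorem bddMeas_lms (h : LMSData ρ Φ y T th lam η R) (t : ℕ) :
    BddMeas (fun z : ℕ → Z => lms Φ y η lam z t) := by
  induction t with
  | zero => exact bddMeas_const 0
  | succ t ih =>
    have h1 := h.bddMeas_feature.comp (measurable_pi_apply (X := fun _ : ℕ => Z) t)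
    have h2 := h.bddMeas_label.comp (measurable_pi_apply (X := fun _ : ℕ => Z) t)
    exact ((bddMeas_const (1 - η * lam)).smul ih).sub
      ((bddMeas_const η).smul (((h1.inner ih).sub h2).smul h1))

theorem bddMeas_gradNoise (h : LMSData ρ Φ y T th lam η R) {Ω : Type*} [MeasurableSpace Ω]
    {f : Ω → E} (hf : BddMeas f) {g : Ω → Z} (hg : Measurable g) :
    BddMeas (fun w => gradNoise Φ y T th lam (f w) (g w)) :=
  (((hf.sub (bddMeas_const th)).clm T).sub (bddMeas_const _)).sub
    ((((h.bddMeas_feature.comp hg).inner hf).sub (h.bddMeas_label.comp hg)).smul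
      (h.bddMeas_feature.comp hg))

theorem symm (h : LMSData ρ Φ y T th lam η R) (v w : E) : ⟪v, T w⟫_ℝ = ⟪T v, w⟫_ℝ := by
  rw [h.cov, real_inner_comm w, h.cov]
  simp only [mul_comm]

variable [IsProbabilityMeasure ρ]

theorem integral_inner_gradNoise (h : LMSData ρ Φ y T th lam η R) (v θ : E) :
    ∫ z, ⟪v, gradNoise Φ y T th lam θ z⟫_ℝ ∂ρ = 0 := by
  have h1 : ∀ z, ⟪v, gradNoise Φ y T th lam θ z⟫_ℝ =
      ⟪v, T (θ - th) - lam • th⟫_ℝ - (⟪Φ z, v⟫_ℝ * ⟪Φ z, θ⟫_ℝ - y z * ⟪Φ z, v⟫_ℝ) := by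
    intro z
    simp only [gradNoise, inner_sub_right, real_inner_smul_right, real_inner_comm v (Φ z)]
    ring
  simp only [h1]
  have i1 := ((h.bddMeas_inner_feature v).mul (h.bddMeas_inner_feature θ)).integrable ρ
  have i2 := (h.bddMeas_label.mul (h.bddMeas_inner_feature v)).integrable ρ
  rw [integral_sub (integrable_const _) (by exact i1.sub i2), integral_sub i1 i2, ← h.cov,
    h.normal_eq]
  simp only [integral_const, probReal_univ, one_smul, map_sub, inner_sub_right, inner_add_right]
  ring

/-- The gradient noise is a centred random vector, so its second moments are at most those of
the stochastic gradient of the unregularized loss. -/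
theorem integral_inner_gradNoise_sq_le (h : LMSData ρ Φ y T th lam η R) (v θ : E) :
    ∫ z, ⟪v, gradNoise Φ y T th lam θ z⟫_ℝ ^ 2 ∂ρ ≤
      ∫ z, (⟪Φ z, θ⟫_ℝ - y z) ^ 2 * ⟪Φ z, v⟫_ℝ ^ 2 ∂ρ := by
  set c := ⟪v, T (θ - th) - lam • th⟫_ℝ
  have bn : BddMeas (fun z => ⟪v, gradNoise Φ y T th lam θ z⟫_ℝ) :=
    (bddMeas_const v).inner (h.bddMeas_gradNoise (bddMeas_const θ) measurable_id)
  have h1 : ∀ z, (⟪Φ z, θ⟫_ℝ - y z) ^ 2 * ⟪Φ z, v⟫_ℝ ^ 2 =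
      (⟪v, gradNoise Φ y T th lam θ z⟫_ℝ + -c * 1) ^ 2 := by
    intro z
    have : ⟪v, gradNoise Φ y T th lam θ z⟫_ℝ = c - (⟪Φ z, θ⟫_ℝ - y z) * ⟪Φ z, v⟫_ℝ := by
      rw [gradNoise, inner_sub_right, real_inner_smul_right, real_inner_comm v (Φ z)]
    rw [this]
    ring
  simp only [h1]
  rw [bn.integral_add_mul_sq (bddMeas_const (1 : ℝ)) ρ (-c)]
  simp only [mul_one, h.integral_inner_gradNoise]
  simp
  positivity

/-- The distance between a stochastic gradient step from `θ` and a gradient step from `m`: a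
contraction of `θ - m` plus noise. With `m = th` the gradient step does not move. -/
theorem lms_succ_sub (θ m : E) (z : Z) :
    ((1 - η * lam) • θ - η • ((⟪Φ z, θ⟫_ℝ - y z) • Φ z)) -
        (m - η • (T (m - th) + lam • (m - th))) =
      (θ - m) - η • (T (θ - m) + lam • (θ - m)) + η • gradNoise Φ y T th lam θ z := by
  simp only [gradNoise, map_sub]
  module

theorem inner_lms_succ_sub_meanIter (h : LMSData ρ Φ y T th lam η R) (v : E) (z : ℕ → Z) (t : ℕ) :
    ⟪v, lms Φ y η lam z (t + 1) - meanIter T th η lam (t + 1)⟫_ℝ =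
      ⟪v - η • (T v + lam • v), lms Φ y η lam z t - meanIter T th η lam t⟫_ℝ +
        η * ⟪v, gradNoise Φ y T th lam (lms Φ y η lam z t) (z t)⟫_ℝ := by
  rw [lms, meanIter, lms_succ_sub]
  simp only [inner_add_right, inner_sub_right (x := v), real_inner_smul_right, h.symm,
    inner_sub_left, inner_add_left, real_inner_smul_left]

/-- The noise at time `t` is orthogonal to every bounded random variable of the past. -/
theorem integral_mul_gradNoise (h : LMSData ρ Φ y T th lam η R) (v : E) (t : ℕ)
    {f : (ℕ → Z) → ℝ} (hf : BddMeas f) (hinv : ∀ z a, f (Function.update z t a) = f z) :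
    ∫ z, f z * ⟪v, gradNoise Φ y T th lam (lms Φ y η lam z t) (z t)⟫_ℝ
      ∂(Measure.infinitePi fun _ : ℕ => ρ) = 0 := by
  rw [integral_infinitePi_eval ρ t
    (f := fun z a => f z * ⟪v, gradNoise Φ y T th lam (lms Φ y η lam z t) a⟫_ℝ)]
  · simp [integral_const_mul, h.integral_inner_gradNoise]
  · exact (hf.comp measurable_fst).mul ((bddMeas_const v).inner
      (h.bddMeas_gradNoise ((h.bddMeas_lms t).comp measurable_fst) measurable_snd))
  · intro z a b
    simp only [hinv, lms_update Φ y η lam z le_rfl]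

theorem bddMeas_inner_noise (h : LMSData ρ Φ y T th lam η R) (v : E) (t : ℕ) :
    BddMeas (fun z : ℕ → Z => ⟪v, gradNoise Φ y T th lam (lms Φ y η lam z t) (z t)⟫_ℝ) :=
  (bddMeas_const v).inner (h.bddMeas_gradNoise (h.bddMeas_lms t) (measurable_pi_apply t))

theorem bddMeas_inner_dev (h : LMSData ρ Φ y T th lam η R) (v : E) (t : ℕ) :
    BddMeas (fun z : ℕ → Z => ⟪v, lms Φ y η lam z t - meanIter T th η lam t⟫_ℝ) :=
  (bddMeas_const v).inner ((h.bddMeas_lms t).sub (bddMeas_const _))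

theorem integral_inner_lms_sub_meanIter (h : LMSData ρ Φ y T th lam η R) (v : E) (t : ℕ) :
    ∫ z, ⟪v, lms Φ y η lam z t - meanIter T th η lam t⟫_ℝ
      ∂(Measure.infinitePi fun _ : ℕ => ρ) = 0 := by
  induction t generalizing v with
  | zero => simp [lms, meanIter]
  | succ t ih =>
    have h0 := h.integral_mul_gradNoise v t (bddMeas_const (1 : ℝ)) (fun _ _ => rfl)
    simp only [one_mul] at h0
    simp only [h.inner_lms_succ_sub_meanIter v]
    rw [integral_add ((h.bddMeas_inner_dev _ t).integrable _)
      (((h.bddMeas_inner_noise v t).integrable _).const_mul η), integral_const_mul, ih, h0]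
    simp

section Spectral

variable {ι : Type*} [Fintype ι] (u : OrthonormalBasis ι ℝ E) {τ : ι → ℝ}

theorem eigenvalue_mem (h : LMSData ρ Φ y T th lam η R) (hu : ∀ j, T (u j) = τ j • u j) (j : ι) :
    0 ≤ τ j ∧ τ j ≤ R := by
  have h1 : τ j = ∫ z, ⟪Φ z, u j⟫_ℝ * ⟪Φ z, u j⟫_ℝ ∂ρ := by
    rw [← h.cov, hu, real_inner_smul_right, real_inner_self_eq_norm_sq]
    simp
  refine ⟨h1 ▸ integral_nonneg fun z => mul_self_nonneg _, ?_⟩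
  have h2 : ∀ z, ⟪Φ z, u j⟫_ℝ * ⟪Φ z, u j⟫_ℝ ≤ R := by
    intro z
    have := abs_real_inner_le_norm (Φ z) (u j)
    rw [u.norm_eq_one, mul_one] at this
    calc ⟪Φ z, u j⟫_ℝ * ⟪Φ z, u j⟫_ℝ = |⟪Φ z, u j⟫_ℝ| ^ 2 := by rw [sq_abs, pow_two]
      _ ≤ ‖Φ z‖ ^ 2 := pow_le_pow_left₀ (abs_nonneg _) this 2
      _ ≤ R := h.norm_feature z
  have h3 := integral_mono
    (((h.bddMeas_inner_feature (u j)).mul (h.bddMeas_inner_feature (u j))).integrable ρ)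
    (integrable_const R) h2
  rw [h1]
  simpa using h3

theorem inner_map (h : LMSData ρ Φ y T th lam η R) (hu : ∀ j, T (u j) = τ j • u j) (j : ι)
    (v : E) : ⟪u j, T v⟫_ℝ = τ j * ⟪u j, v⟫_ℝ := by
  rw [h.symm, hu, real_inner_smul_left]

theorem step_mul_le (h : LMSData ρ Φ y T th lam η R) (hu : ∀ j, T (u j) = τ j • u j) (j : ι) :
    0 < τ j + lam ∧ η * (τ j + lam) ≤ 1 / 2 := by
  obtain ⟨h1, h2⟩ := h.eigenvalue_mem u hu j
  refine ⟨by linarith [h.lam_pos], le_trans ?_ h.step_le⟩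
  exact mul_le_mul_of_nonneg_left (by linarith) h.step_pos.le

theorem norm_sq_eq_sum (v : E) : ‖v‖ ^ 2 = ∑ j, ⟪u j, v⟫_ℝ ^ 2 := by
  rw [← u.sum_sq_norm_inner_right v]
  simp

theorem norm_meanIter_le (h : LMSData ρ Φ y T th lam η R) (hu : ∀ j, T (u j) = τ j • u j)
    (t : ℕ) : ‖meanIter T th η lam t‖ ≤ ‖th‖ := by
  have h1 : ∀ j, ⟪u j, meanIter T th η lam t⟫_ℝ =
      (1 - (1 - η * (τ j + lam)) ^ t) * ⟪u j, th⟫_ℝ := by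
    intro j
    induction t with
    | zero => simp [meanIter]
    | succ t ih =>
      simp only [meanIter, inner_sub_right, inner_add_right, real_inner_smul_right,
        h.inner_map u hu, ih, pow_succ]
      ring
  refine le_of_sq_le_sq ?_ (norm_nonneg _)
  rw [norm_sq_eq_sum u, norm_sq_eq_sum u th]
  refine Finset.sum_le_sum fun j _ => ?_
  obtain ⟨ha, hb⟩ := h.step_mul_le u hu j
  have hc : 0 < η * (τ j + lam) := mul_pos h.step_pos ha
  have hq0 : 0 ≤ (1 - η * (τ j + lam)) ^ t := pow_nonneg (by linarith) t
  have hq1 : (1 - η * (τ j + lam)) ^ t ≤ 1 := pow_le_one₀ (by linarith) (by linarith)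
  rw [h1, mul_pow]
  exact mul_le_of_le_one_left (sq_nonneg _) (pow_le_one₀ (by linarith) (by linarith))

/-- One step of gradient descent contracts enough to absorb the noise injected by one sample. -/
theorem norm_sq_step_add_le (h : LMSData ρ Φ y T th lam η R) (hu : ∀ j, T (u j) = τ j • u j)
    (v : E) : ‖v - η • (T v + lam • v)‖ ^ 2 + 3 / 2 * η * ⟪v, T v⟫_ℝ ≤ ‖v‖ ^ 2 := by
  have h1 : ⟪v, T v⟫_ℝ = ∑ j, τ j * ⟪u j, v⟫_ℝ ^ 2 := by
    rw [← u.sum_inner_mul_inner]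
    refine Finset.sum_congr rfl fun j _ => ?_
    rw [h.inner_map u hu, real_inner_comm]
    ring
  rw [norm_sq_eq_sum u, norm_sq_eq_sum u v, h1, Finset.mul_sum, ← Finset.sum_add_distrib]
  refine Finset.sum_le_sum fun j _ => ?_
  obtain ⟨ha, hb⟩ := h.step_mul_le u hu j
  have hc : 0 < η * (τ j + lam) := mul_pos h.step_pos ha
  have hl : 0 < η * lam := mul_pos h.step_pos h.lam_pos
  simp only [inner_sub_right, inner_add_right, real_inner_smul_right, h.inner_map u hu]
  have : (1 - η * (τ j + lam)) ^ 2 + 3 / 2 * η * τ j ≤ 1 := by nlinarith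
  nlinarith [mul_le_mul_of_nonneg_right this (sq_nonneg ⟪u j, v⟫_ℝ)]

/-- The residuals of the mean iterates are uniformly bounded. -/
theorem residual_meanIter_sq_le (h : LMSData ρ Φ y T th lam η R)
    (hu : ∀ j, T (u j) = τ j • u j) (t : ℕ) (z : Z) :
    (⟪Φ z, meanIter T th η lam t⟫_ℝ - y z) ^ 2 ≤ 2 * (1 + R * ‖th‖ ^ 2) := by
  have h1 : ⟪Φ z, meanIter T th η lam t⟫_ℝ ^ 2 ≤ R * ‖th‖ ^ 2 := by
    rw [← sq_abs]
    calc |⟪Φ z, meanIter T th η lam t⟫_ℝ| ^ 2 ≤ (‖Φ z‖ * ‖th‖) ^ 2 :=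
          pow_le_pow_left₀ (abs_nonneg _) ((abs_real_inner_le_norm _ _).trans
            (mul_le_mul_of_nonneg_left (h.norm_meanIter_le u hu t) (norm_nonneg _))) 2
      _ = ‖Φ z‖ ^ 2 * ‖th‖ ^ 2 := mul_pow _ _ _
      _ ≤ R * ‖th‖ ^ 2 := mul_le_mul_of_nonneg_right (h.norm_feature z) (sq_nonneg _)
  have h2 : y z ^ 2 ≤ 1 := by
    rw [← sq_abs]
    exact pow_le_one₀ (abs_nonneg _) (h.abs_label z)
  nlinarith [sq_nonneg (⟪Φ z, meanIter T th η lam t⟫_ℝ + y z)]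

/-- If the deviation of the iterates from their mean has covariance at most `η S`, where `S` is
the uniform bound for the squared residuals, then the noise has covariance at most `(3/2) S T`. -/
theorem integral_noise_sq_le_of_dev (h : LMSData ρ Φ y T th lam η R)
    (hu : ∀ j, T (u j) = τ j • u j) (t : ℕ)
    (hdev : ∀ v, ∫ z, ⟪v, lms Φ y η lam z t - meanIter T th η lam t⟫_ℝ ^ 2
      ∂(Measure.infinitePi fun _ : ℕ => ρ) ≤ η * (2 * (1 + R * ‖th‖ ^ 2)) * ‖v‖ ^ 2) (v : E) :
    ∫ z, ⟪v, gradNoise Φ y T th lam (lms Φ y η lam z t) (z t)⟫_ℝ ^ 2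
      ∂(Measure.infinitePi fun _ : ℕ => ρ) ≤
        3 / 2 * (2 * (1 + R * ‖th‖ ^ 2)) * ⟪v, T v⟫_ℝ := by
  set S := 2 * (1 + R * ‖th‖ ^ 2) with hS
  set P := Measure.infinitePi fun _ : ℕ => ρ
  have hR : 0 ≤ R := by
    obtain ⟨z⟩ : Nonempty Z := nonempty_of_isProbabilityMeasure ρ
    exact (sq_nonneg _).trans (h.norm_feature z)
  have hS0 : 0 ≤ S := by positivity
  have bl : BddMeas (fun p : (ℕ → Z) × Z => lms Φ y η lam p.1 t) :=
    (h.bddMeas_lms t).comp measurable_fst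
  have br : BddMeas (fun p : (ℕ → Z) × Z => (⟪Φ p.2, lms Φ y η lam p.1 t⟫_ℝ - y p.2) ^ 2) :=
    (((h.bddMeas_feature.comp measurable_snd).inner bl).sub
      (h.bddMeas_label.comp measurable_snd)).sq
  have bv : BddMeas (fun p : (ℕ → Z) × Z => ⟪Φ p.2, v⟫_ℝ ^ 2) :=
    ((h.bddMeas_inner_feature v).comp measurable_snd).sq
  have bn : BddMeas (fun p : (ℕ → Z) × Z =>
      ⟪v, gradNoise Φ y T th lam (lms Φ y η lam p.1 t) p.2⟫_ℝ ^ 2) :=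
    ((bddMeas_const v).inner (h.bddMeas_gradNoise bl measurable_snd)).sq
  have hres : ∀ a, ∫ z, (⟪Φ a, lms Φ y η lam z t⟫_ℝ - y a) ^ 2 ∂P ≤ 3 / 2 * S := by
    intro a
    have hexp : ∀ z, (⟪Φ a, lms Φ y η lam z t⟫_ℝ - y a) ^ 2 =
        (⟪Φ a, lms Φ y η lam z t - meanIter T th η lam t⟫_ℝ +
          (⟪Φ a, meanIter T th η lam t⟫_ℝ - y a) * 1) ^ 2 := by
      intro z
      rw [inner_sub_right]
      ring
    simp only [hexp]
    rw [(h.bddMeas_inner_dev (Φ a) t).integral_add_mul_sq (bddMeas_const (1 : ℝ))]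
    have h0 : ∫ z, ⟪Φ a, lms Φ y η lam z t - meanIter T th η lam t⟫_ℝ ∂P = 0 :=
      h.integral_inner_lms_sub_meanIter (Φ a) t
    simp only [mul_one, h0, mul_zero, add_zero, one_pow, integral_const, probReal_univ, one_smul]
    have h1 := hdev (Φ a)
    have h2 := h.residual_meanIter_sq_le u hu t a
    have h3 : η * S * ‖Φ a‖ ^ 2 ≤ 1 / 2 * S := by
      have h4 : η * ‖Φ a‖ ^ 2 ≤ 1 / 2 := by
        nlinarith [h.step_le, h.norm_feature a, h.step_pos, mul_pos h.step_pos h.lam_pos]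
      nlinarith
    linarith
  calc ∫ z, ⟪v, gradNoise Φ y T th lam (lms Φ y η lam z t) (z t)⟫_ℝ ^ 2 ∂P
      = ∫ z, ∫ a, ⟪v, gradNoise Φ y T th lam (lms Φ y η lam z t) a⟫_ℝ ^ 2 ∂ρ ∂P := by
        refine integral_infinitePi_eval ρ t
          (f := fun z a => ⟪v, gradNoise Φ y T th lam (lms Φ y η lam z t) a⟫_ℝ ^ 2) bn ?_
        intro z a b
        rw [lms_update Φ y η lam z le_rfl]
    _ ≤ ∫ z, ∫ a, (⟪Φ a, lms Φ y η lam z t⟫_ℝ - y a) ^ 2 * ⟪Φ a, v⟫_ℝ ^ 2 ∂ρ ∂P :=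
        integral_mono (bn.integrable (P.prod ρ)).integral_prod_left
          ((br.mul bv).integrable (P.prod ρ)).integral_prod_left
          fun z => h.integral_inner_gradNoise_sq_le v _
    _ = ∫ a, ∫ z, (⟪Φ a, lms Φ y η lam z t⟫_ℝ - y a) ^ 2 * ⟪Φ a, v⟫_ℝ ^ 2 ∂P ∂ρ :=
        integral_integral_swap ((br.mul bv).integrable (P.prod ρ))
    _ ≤ ∫ a, 3 / 2 * S * ⟪Φ a, v⟫_ℝ ^ 2 ∂ρ := by
        refine integral_mono ((br.mul bv).integrable (P.prod ρ)).integral_prod_right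
          (((h.bddMeas_inner_feature v).sq.integrable ρ).const_mul _) fun a => ?_
        simp only [integral_mul_const]
        exact mul_le_mul_of_nonneg_right (hres a) (sq_nonneg _)
    _ = 3 / 2 * S * ⟪v, T v⟫_ℝ := by
        rw [integral_const_mul, h.cov]
        simp only [pow_two]

/-- The covariance of the iterates is at most `η S`, where `S` bounds the squared residuals of
the mean iterates: the contraction of a step outweighs the noise injected by it. -/
theorem integral_dev_sq_le (h : LMSData ρ Φ y T th lam η R) (hu : ∀ j, T (u j) = τ j • u j)
    (t : ℕ) (v : E) :
    ∫ z, ⟪v, lms Φ y η lam z t - meanIter T th η lam t⟫_ℝ ^ 2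
      ∂(Measure.infinitePi fun _ : ℕ => ρ) ≤ η * (2 * (1 + R * ‖th‖ ^ 2)) * ‖v‖ ^ 2 := by
  have hR : 0 ≤ R := by
    obtain ⟨z⟩ : Nonempty Z := nonempty_of_isProbabilityMeasure ρ
    exact (sq_nonneg _).trans (h.norm_feature z)
  have hη := h.step_pos
  induction t generalizing v with
  | zero =>
    simp [lms, meanIter]
    positivity
  | succ t ih =>
    set w := v - η • (T v + lam • v) with hw
    have bd := h.bddMeas_inner_dev w t
    have bn := h.bddMeas_inner_noise v t
    simp only [h.inner_lms_succ_sub_meanIter v]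
    rw [bd.integral_add_mul_sq bn,
      h.integral_mul_gradNoise v t bd fun z a => by rw [lms_update Φ y η lam z le_rfl]]
    have h1 := ih w
    have h2 := h.integral_noise_sq_le_of_dev u hu t ih v
    have h3 := h.norm_sq_step_add_le u hu v
    set S := 2 * (1 + R * ‖th‖ ^ 2) with hS
    have hS0 : 0 ≤ η * S := by positivity
    have h4 := mul_le_mul_of_nonneg_left h2 (sq_nonneg η)
    have h5 := mul_le_mul_of_nonneg_left h3 hS0
    rw [← hw] at h5
    linarith

theorem integral_noise_sq_le (h : LMSData ρ Φ y T th lam η R) (hu : ∀ j, T (u j) = τ j • u j)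
    (t : ℕ) (v : E) :
    ∫ z, ⟪v, gradNoise Φ y T th lam (lms Φ y η lam z t) (z t)⟫_ℝ ^ 2
      ∂(Measure.infinitePi fun _ : ℕ => ρ) ≤
        3 / 2 * (2 * (1 + R * ‖th‖ ^ 2)) * ⟪v, T v⟫_ℝ :=
  h.integral_noise_sq_le_of_dev u hu t (h.integral_dev_sq_le u hu t) v

/-- Second moment of a constant plus a weighted sum of the (orthogonal) noises. -/
theorem integral_sq_const_add_sum_noise_le (h : LMSData ρ Φ y T th lam η R)
    (v : E) {K : ℝ} (hK : ∀ t, ∫ z, ⟪v, gradNoise Φ y T th lam (lms Φ y η lam z t) (z t)⟫_ℝ ^ 2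
      ∂(Measure.infinitePi fun _ : ℕ => ρ) ≤ K) (c : ℝ) (d : ℕ → ℝ) (hd : ∀ s, d s ^ 2 ≤ 1)
    (n : ℕ) :
    ∫ z, (c + ∑ s ∈ Finset.range n,
        d s * ⟪v, gradNoise Φ y T th lam (lms Φ y η lam z s) (z s)⟫_ℝ) ^ 2
      ∂(Measure.infinitePi fun _ : ℕ => ρ) ≤ c ^ 2 + n * K := by
  induction n with
  | zero => simp
  | succ n ih =>
    have bn := h.bddMeas_inner_noise v n
    have bs : BddMeas (fun z : ℕ → Z => c + ∑ s ∈ Finset.range n,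
        d s * ⟪v, gradNoise Φ y T th lam (lms Φ y η lam z s) (z s)⟫_ℝ) :=
      (bddMeas_const c).add (BddMeas.sum _ fun s _ =>
        (bddMeas_const (d s)).mul (h.bddMeas_inner_noise v s))
    have hinv : ∀ (z : ℕ → Z) (a : Z), (c + ∑ s ∈ Finset.range n,
        d s * ⟪v, gradNoise Φ y T th lam (lms Φ y η lam (Function.update z n a) s)
          (Function.update z n a s)⟫_ℝ) = c + ∑ s ∈ Finset.range n,
        d s * ⟪v, gradNoise Φ y T th lam (lms Φ y η lam z s) (z s)⟫_ℝ := by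
      intro z a
      congr 1
      refine Finset.sum_congr rfl fun s hs => ?_
      have hsn := Finset.mem_range.1 hs
      rw [lms_update Φ y η lam z hsn.le, Function.update_of_ne hsn.ne]
    simp only [Finset.sum_range_succ, ← add_assoc]
    rw [bs.integral_add_mul_sq bn, h.integral_mul_gradNoise v n bs hinv]
    have h1 : 0 ≤ ∫ z, ⟪v, gradNoise Φ y T th lam (lms Φ y η lam z n) (z n)⟫_ℝ ^ 2
        ∂(Measure.infinitePi fun _ : ℕ => ρ) := integral_nonneg fun z => sq_nonneg _
    have h2 := mul_le_of_le_one_left h1 (hd n)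
    have h3 := hK n
    push_cast
    linarith

/-- The sum of the errors in the direction of an eigenvector is, up to the factor
`η (τ + lam)`, a damped initial error plus a damped sum of the noises. -/
theorem sum_inner_lms_sub (h : LMSData ρ Φ y T th lam η R) (hu : ∀ j, T (u j) = τ j • u j)
    (j : ι) (z : ℕ → Z) (n : ℕ) :
    η * (τ j + lam) * ∑ t ∈ Finset.range n, ⟪u j, lms Φ y η lam z t - th⟫_ℝ =
      -((1 - (1 - η * (τ j + lam)) ^ n) * ⟪u j, th⟫_ℝ) + ∑ s ∈ Finset.range n,
        (1 - (1 - η * (τ j + lam)) ^ (n - 1 - s)) *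
          (η * ⟪u j, gradNoise Φ y T th lam (lms Φ y η lam z s) (z s)⟫_ℝ) := by
  set q := 1 - η * (τ j + lam) with hq
  set x : ℕ → ℝ := fun t => ⟪u j, lms Φ y η lam z t - th⟫_ℝ with hx
  set ζ : ℕ → ℝ := fun s => η * ⟪u j, gradNoise Φ y T th lam (lms Φ y η lam z s) (z s)⟫_ℝ
    with hζ
  have hx0 : x 0 = -⟪u j, th⟫_ℝ := by simp [hx, lms]
  have hrec : ∀ t, x (t + 1) = q * x t + ζ t := by
    intro t
    have h1 := lms_succ_sub (Φ := Φ) (y := y) (T := T) (th := th) (lam := lam) (η := η)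
      (lms Φ y η lam z t) th (z t)
    simp only [sub_self, map_zero, smul_zero, add_zero, sub_zero] at h1
    have h2 : x (t + 1) = ⟪u j, _⟫_ℝ := congrArg (fun w => ⟪u j, w⟫_ℝ) h1
    rw [h2]
    simp only [hx, inner_add_right, inner_sub_right, real_inner_smul_right,
      h.inner_map u hu, hζ, hq, map_sub]
    ring
  have htel : η * (τ j + lam) * ∑ t ∈ Finset.range n, x t =
      x 0 - x n + ∑ s ∈ Finset.range n, ζ s := by
    clear_value x ζ
    induction n with
    | zero => simp
    | succ n ih =>
      rw [Finset.sum_range_succ, Finset.sum_range_succ, mul_add, ih, hrec, hq]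
      ring
  have hxn : x n = q ^ n * x 0 + ∑ s ∈ Finset.range n, q ^ (n - 1 - s) * ζ s := by
    clear_value x ζ
    clear htel
    induction n with
    | zero => simp
    | succ n ih =>
      rw [hrec, ih, Finset.sum_range_succ, mul_add, Finset.mul_sum]
      have : ∀ s ∈ Finset.range n, q * (q ^ (n - 1 - s) * ζ s) = q ^ (n + 1 - 1 - s) * ζ s := by
        intro s hs
        have hs' := Finset.mem_range.1 hs
        rw [show n + 1 - 1 - s = (n - 1 - s) + 1 by omega, pow_succ]
        ring
      rw [Finset.sum_congr rfl this]
      simp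
      ring
  rw [htel, hxn, hx0]
  simp only [sub_mul, one_mul, Finset.sum_sub_distrib]
  ring

/-- The expected excess risk of the averaged iterates: a bias term which decays like the square
of the number of steps, and a variance term governed by the degrees of freedom. -/
theorem integral_average_le (h : LMSData ρ Φ y T th lam η R) (hu : ∀ j, T (u j) = τ j • u j)
    (n : ℕ) :
    ∫ z, ∑ j, τ j * ⟪u j, (1 / ((n : ℝ) + 1)) •
        (∑ t ∈ Finset.range (n + 1), lms Φ y η lam z t) - th⟫_ℝ ^ 2
      ∂(Measure.infinitePi fun _ : ℕ => ρ) ≤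
      1 / (η ^ 2 * ((n : ℝ) + 1) ^ 2) * ∑ j, τ j * (⟪u j, th⟫_ℝ / (τ j + lam)) ^ 2 +
        3 * (1 + R * ‖th‖ ^ 2) / ((n : ℝ) + 1) * ∑ j, τ j / (τ j + lam) := by
  have hN : (0 : ℝ) < (n : ℝ) + 1 := by positivity
  have bav : ∀ j, BddMeas (fun z : ℕ → Z => ⟪u j, (1 / ((n : ℝ) + 1)) •
        (∑ t ∈ Finset.range (n + 1), lms Φ y η lam z t) - th⟫_ℝ ^ 2) := fun j =>
    ((bddMeas_const (u j)).inner (((bddMeas_const _).smul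
      (BddMeas.sum _ fun t _ => h.bddMeas_lms t)).sub (bddMeas_const th))).sq
  rw [integral_finsetSum _ fun j _ => ((bav j).integrable _).const_mul (τ j),
    Finset.mul_sum, Finset.mul_sum, ← Finset.sum_add_distrib]
  refine Finset.sum_le_sum fun j _ => ?_
  rw [integral_const_mul]
  obtain ⟨hτ, -⟩ := h.eigenvalue_mem u hu j
  obtain ⟨ha, hb⟩ := h.step_mul_le u hu j
  have hη := h.step_pos
  set a := τ j + lam with haj
  have hc : 0 < η * a := mul_pos hη ha
  set S := 2 * (1 + R * ‖th‖ ^ 2) with hS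
  have hR : 0 ≤ R := by
    obtain ⟨z⟩ : Nonempty Z := nonempty_of_isProbabilityMeasure ρ
    exact (sq_nonneg _).trans (h.norm_feature z)
  have hS0 : 0 ≤ S := by positivity
  have hpow : ∀ k, (1 - (1 - η * a) ^ k) ^ 2 ≤ 1 := by
    intro k
    have hq0 : 0 ≤ (1 - η * a) ^ k := pow_nonneg (by linarith) k
    have hq1 : (1 - η * a) ^ k ≤ 1 := pow_le_one₀ (by linarith) (by linarith)
    exact pow_le_one₀ (by linarith) (by linarith)
  have hK : ∀ t, ∫ z, ⟪u j, gradNoise Φ y T th lam (lms Φ y η lam z t) (z t)⟫_ℝ ^ 2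
      ∂(Measure.infinitePi fun _ : ℕ => ρ) ≤ 3 / 2 * S * τ j := by
    intro t
    refine (h.integral_noise_sq_le u hu t (u j)).trans_eq ?_
    rw [hu, real_inner_smul_right, real_inner_self_eq_norm_sq]
    simp [hS]
  have hkey : ∀ z : ℕ → Z, ⟪u j, (1 / ((n : ℝ) + 1)) •
        (∑ t ∈ Finset.range (n + 1), lms Φ y η lam z t) - th⟫_ℝ ^ 2 =
      1 / (a ^ 2 * ((n : ℝ) + 1) ^ 2) *
      (-((1 - (1 - η * a) ^ (n + 1)) * ⟪u j, th⟫_ℝ / η) + ∑ s ∈ Finset.range (n + 1),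
        (1 - (1 - η * a) ^ (n + 1 - 1 - s)) *
          ⟪u j, gradNoise Φ y T th lam (lms Φ y η lam z s) (z s)⟫_ℝ) ^ 2 := by
    intro z
    have h1 := h.sum_inner_lms_sub u hu j z (n + 1)
    have h2 : ⟪u j, (1 / ((n : ℝ) + 1)) •
        (∑ t ∈ Finset.range (n + 1), lms Φ y η lam z t) - th⟫_ℝ = 1 / ((n : ℝ) + 1) *
          ∑ t ∈ Finset.range (n + 1), ⟪u j, lms Φ y η lam z t - th⟫_ℝ := by
      simp only [inner_sub_right, real_inner_smul_right, inner_sum, Finset.sum_sub_distrib,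
        Finset.sum_const, Finset.card_range, nsmul_eq_mul]
      push_cast
      field_simp
    have h3 : ∑ t ∈ Finset.range (n + 1), ⟪u j, lms Φ y η lam z t - th⟫_ℝ = 1 / a *
      (-((1 - (1 - η * a) ^ (n + 1)) * ⟪u j, th⟫_ℝ / η) + ∑ s ∈ Finset.range (n + 1),
        (1 - (1 - η * a) ^ (n + 1 - 1 - s)) *
          ⟪u j, gradNoise Φ y T th lam (lms Φ y η lam z s) (z s)⟫_ℝ) := by
      simp only [mul_left_comm _ η, ← Finset.mul_sum] at h1
      rw [← haj] at h1
      generalize (1 - (1 - η * a) ^ (n + 1)) * ⟪u j, th⟫_ℝ = c at h1 ⊢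
      generalize ∑ s ∈ Finset.range (n + 1), (1 - (1 - η * a) ^ (n + 1 - 1 - s)) *
        ⟪u j, gradNoise Φ y T th lam (lms Φ y η lam z s) (z s)⟫_ℝ = D at h1 ⊢
      field_simp
      linarith
    rw [h2, h3]
    field_simp
  simp only [hkey]
  rw [integral_const_mul]
  have hfin := h.integral_sq_const_add_sum_noise_le (u j) hK
    (-((1 - (1 - η * a) ^ (n + 1)) * ⟪u j, th⟫_ℝ / η))
    (fun s => 1 - (1 - η * a) ^ (n + 1 - 1 - s)) (fun s => hpow _) (n + 1)
  have hbias : (-((1 - (1 - η * a) ^ (n + 1)) * ⟪u j, th⟫_ℝ / η)) ^ 2 ≤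
      ⟪u j, th⟫_ℝ ^ 2 / η ^ 2 := by
    rw [neg_sq, mul_div_assoc, mul_pow, div_pow]
    exact mul_le_of_le_one_left (by positivity) (hpow _)
  have htot := hfin.trans (add_le_add_left hbias _)
  push_cast at htot
  have hmul := mul_le_mul_of_nonneg_left htot
    (show 0 ≤ τ j * (1 / (a ^ 2 * ((n : ℝ) + 1) ^ 2)) by positivity)
  rw [← mul_assoc]
  refine hmul.trans ?_
  have e1 : τ j * (1 / (a ^ 2 * ((n : ℝ) + 1) ^ 2)) *
      (⟪u j, th⟫_ℝ ^ 2 / η ^ 2 + ((n : ℝ) + 1) * (3 / 2 * S * τ j)) =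
      1 / (η ^ 2 * ((n : ℝ) + 1) ^ 2) * (τ j * (⟪u j, th⟫_ℝ / a) ^ 2) +
        3 / 2 * S / ((n : ℝ) + 1) * (τ j / a * (τ j / a)) := by
    field_simp
  have e2 : τ j / a * (τ j / a) ≤ τ j / a :=
    mul_le_of_le_one_right (by positivity) ((div_le_one ha).2 (by linarith [h.lam_pos]))
  rw [e1, show 3 * (1 + R * ‖th‖ ^ 2) = 3 / 2 * S by rw [hS]; ring]
  exact add_le_add_right (mul_le_mul_of_nonneg_left e2 (by positivity)) _

end Spectral

end LMSData

end LeastMeanSquares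


/-! ### Resolvents, traces and powers of positive operators -/

section Positive

variable {F : Type*} [NormedAddCommGroup F] [InnerProductSpace ℝ F] [CompleteSpace F]

theorem isUnit_add_smul_one {A : F →L[ℝ] F} (hA : ∀ f, 0 ≤ ⟪f, A f⟫_ℝ) {lam : ℝ}
    (hlam : 0 < lam) : IsUnit (A + lam • (1 : F →L[ℝ] F)) := by
  refine ContinuousLinearMap.isUnit_of_forall_le_norm_inner_map _ (c := ⟨lam, hlam.le⟩) hlam ?_
  intro f
  have h1 : ⟪(A + lam • (1 : F →L[ℝ] F)) f, f⟫_ℝ = ⟪f, A f⟫_ℝ + lam * ‖f‖ ^ 2 := by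
    rw [real_inner_comm]
    simp [inner_add_right, real_inner_smul_right]
  rw [h1, Real.norm_of_nonneg (add_nonneg (hA f) (by positivity))]
  change ‖f‖ ^ 2 * lam ≤ _
  linarith [hA f]

theorem add_resolvent_apply {A : F →L[ℝ] F} (hA : ∀ f, 0 ≤ ⟪f, A f⟫_ℝ) {lam : ℝ}
    (hlam : 0 < lam) (f : F) : A (resolvent A lam f) + lam • resolvent A lam f = f := by
  have h := Ring.mul_inverse_cancel _ (isUnit_add_smul_one hA hlam)
  simpa [resolvent] using congrArg (fun B : F →L[ℝ] F => B f) h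

theorem resolvent_add_apply {A : F →L[ℝ] F} (hA : ∀ f, 0 ≤ ⟪f, A f⟫_ℝ) {lam : ℝ}
    (hlam : 0 < lam) (f : F) : resolvent A lam (A f + lam • f) = f := by
  have h := Ring.inverse_mul_cancel _ (isUnit_add_smul_one hA hlam)
  simpa [resolvent] using congrArg (fun B : F →L[ℝ] F => B f) h

theorem rpow_div_le {r ν lam : ℝ} (hr : r ∈ Icc (1 / 2 : ℝ) 1) (hν : 0 ≤ ν) (hlam : 0 < lam) :
    (ν ^ r) ^ 2 / (ν + lam) ≤ 1 / 9 * (ν ^ r) ^ 2 + 9 / 4 := by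
  obtain ⟨hr1, hr2⟩ := hr
  rcases hν.eq_or_lt with rfl | hν
  · rw [Real.zero_rpow (by linarith)]
    norm_num
  have h1 : (ν ^ r) ^ 2 = ν ^ (2 * r - 1) * ν := by
    rw [← Real.rpow_natCast, ← Real.rpow_mul hν.le, ← Real.rpow_add_one hν.ne']
    congr 1
    push_cast
    ring
  have h0 : 0 < ν ^ (2 * r - 1) := Real.rpow_pos_of_pos hν _
  have h2 : (ν ^ r) ^ 2 / (ν + lam) ≤ ν ^ (2 * r - 1) := by
    rw [div_le_iff₀ (by linarith), h1]
    exact mul_le_mul_of_nonneg_left (by linarith) h0.le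
  refine h2.trans ?_
  rw [h1]
  rcases le_total ν 1 with h | h
  · have := Real.rpow_le_one hν.le h (show 0 ≤ 2 * r - 1 by linarith)
    nlinarith [mul_pos h0 hν]
  · have h3 : ν ^ (2 * r - 1) ≤ ν := by
      simpa using Real.rpow_le_rpow_of_exponent_le h (show 2 * r - 1 ≤ 1 by linarith)
    -- `p (1 - ν / 9) ≤ ν (1 - ν / 9) ≤ 9 / 4` for `p ≤ ν ≤ 9`
    rcases le_total ν 9 with h9 | h9
    · nlinarith [sq_nonneg (ν - 9 / 2),
        mul_le_mul_of_nonneg_right h3 (show 0 ≤ 1 - ν / 9 by linarith)]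
    · nlinarith

/-- If `g = A ^ r G` with `r ∈ [1/2, 1]`, then `⟪(A + lam)⁻¹ g, g⟫` is bounded, uniformly in
`lam`, because `ν ^ (2 r) / (ν + lam) ≤ ν ^ (2 r - 1)` grows at most like `ν ^ (2 r)` at infinity
and is bounded near `0`. -/
theorem inner_le_of_opPow {A : F →L[ℝ] F} (hA : ∀ f, 0 ≤ ⟪f, A f⟫_ℝ)
    (hsymm : ∀ f g, ⟪f, A g⟫_ℝ = ⟪A f, g⟫_ℝ) {lam : ℝ} (hlam : 0 < lam) {r : ℝ}
    (hr : r ∈ Icc (1 / 2 : ℝ) 1) (G u : F) (hu : A u + lam • u = opPow A r G) :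
    ⟪u, opPow A r G⟫_ℝ ≤ 1 / 9 * ‖opPow A r G‖ ^ 2 + 9 / 4 * ‖G‖ ^ 2 := by
  set P : ℝ → F := fun ν => (eigSpace A ν).starProjection G with hP
  have hPA : ∀ ν, A (P ν) = ν • P ν := by
    intro ν
    have : P ν ∈ eigSpace A ν := Submodule.starProjection_apply_mem _ _
    simpa [eigSpace, sub_eq_zero] using this
  have hGP : ∀ ν, ⟪G, P ν⟫_ℝ = ‖P ν‖ ^ 2 := by
    intro ν
    have h := Submodule.inner_starProjection_left_eq_right (eigSpace A ν) G (P ν)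
    rw [Submodule.starProjection_eq_self_iff.2 (Submodule.starProjection_apply_mem _ _)] at h
    rw [← h, real_inner_self_eq_norm_sq]
  have horth : ∀ ν κ, ν ≠ κ → ⟪P ν, P κ⟫_ℝ = 0 := by
    intro ν κ hne
    have h := hsymm (P ν) (P κ)
    rw [hPA, hPA, real_inner_smul_left, real_inner_smul_right] at h
    have : (κ - ν) * ⟪P ν, P κ⟫_ℝ = 0 := by linarith
    exact (mul_eq_zero.1 this).resolve_left (sub_ne_zero.2 hne.symm)
  by_cases hs : Summable fun ν : ℝ => ν ^ r • P ν
  swap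
  · have h0 : opPow A r G = 0 := tsum_eq_zero_of_not_summable hs
    rw [h0]
    simp
  set g := opPow A r G with hg
  have hsum : HasSum (fun ν : ℝ => ν ^ r • P ν) g := hs.hasSum
  have hinner : ∀ v, HasSum (fun ν : ℝ => ν ^ r * ⟪v, P ν⟫_ℝ) ⟪v, g⟫_ℝ := by
    intro v
    simpa [real_inner_smul_right] using hsum.mapL (innerSL ℝ v)
  have hgP : ∀ κ, ⟪g, P κ⟫_ℝ = κ ^ r * ‖P κ‖ ^ 2 := by
    intro κ
    have h1 := hinner (P κ)
    have h2 : HasSum (fun ν : ℝ => ν ^ r * ⟪P κ, P ν⟫_ℝ) (κ ^ r * ⟪P κ, P κ⟫_ℝ) :=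
      hasSum_single κ fun ν hν => by rw [horth κ ν hν.symm, mul_zero]
    rw [real_inner_comm, h1.unique h2, real_inner_self_eq_norm_sq]
  have huP : ∀ κ, (κ + lam) * ⟪u, P κ⟫_ℝ = κ ^ r * ‖P κ‖ ^ 2 := by
    intro κ
    rw [← hgP, ← hu, inner_add_left, ← hsymm, hPA, real_inner_smul_left, real_inner_smul_right]
    ring
  have hneg : ∀ ν, ν < 0 → P ν = 0 := by
    intro ν hν
    have h := hA (P ν)
    rw [hPA, real_inner_smul_right, real_inner_self_eq_norm_sq] at h
    have : ‖P ν‖ ^ 2 = 0 := by nlinarith [sq_nonneg ‖P ν‖]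
    simpa using this
  have hnorm : HasSum (fun ν : ℝ => (ν ^ r) ^ 2 * ‖P ν‖ ^ 2) (‖g‖ ^ 2) := by
    have h := hinner g
    simp only [hgP] at h
    rw [real_inner_self_eq_norm_sq] at h
    exact h.congr_fun fun ν => by ring
  have hbessel : ∀ s : Finset ℝ, ∑ ν ∈ s, ‖P ν‖ ^ 2 ≤ ‖G‖ ^ 2 := by
    intro s
    set w := ∑ ν ∈ s, P ν with hw
    have h1 : ⟪G, w⟫_ℝ = ∑ ν ∈ s, ‖P ν‖ ^ 2 := by
      rw [hw, inner_sum]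
      exact Finset.sum_congr rfl fun ν _ => hGP ν
    have h2 : ‖w‖ ^ 2 = ∑ ν ∈ s, ‖P ν‖ ^ 2 := by
      rw [← real_inner_self_eq_norm_sq, hw, sum_inner]
      refine Finset.sum_congr rfl fun ν hν => ?_
      rw [inner_sum, Finset.sum_eq_single_of_mem ν hν fun κ _ hκ => horth ν κ hκ.symm,
        real_inner_self_eq_norm_sq]
    have h3 := real_inner_le_norm G w
    nlinarith [sq_nonneg (‖G‖ - ‖w‖)]
  have hsP : Summable fun ν : ℝ => ‖P ν‖ ^ 2 :=
    summable_of_sum_le (fun ν => sq_nonneg _) hbessel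
  have hle : ∑' ν : ℝ, ‖P ν‖ ^ 2 ≤ ‖G‖ ^ 2 := hsP.tsum_le_of_sum_le hbessel
  have hfin := hasSum_le (fun ν => ?_) (hinner u)
    ((hnorm.mul_left (1 / 9)).add (hsP.hasSum.mul_left (9 / 4)))
  · linarith
  · rcases lt_or_ge ν 0 with hν | hν
    · simp [hneg ν hν]
    · have hpos : 0 < ν + lam := by linarith
      have h1 : ⟪u, P ν⟫_ℝ = ν ^ r * ‖P ν‖ ^ 2 / (ν + lam) := by
        rw [eq_div_iff hpos.ne', mul_comm, huP]
      have h2 := mul_le_mul_of_nonneg_right (rpow_div_le hr hν hlam) (sq_nonneg ‖P ν‖)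
      rw [h1]
      calc ν ^ r * (ν ^ r * ‖P ν‖ ^ 2 / (ν + lam))
          = (ν ^ r) ^ 2 / (ν + lam) * ‖P ν‖ ^ 2 := by ring
        _ ≤ _ := h2.trans_eq (by ring)

end Positive

/-! ### Finite-dimensional factorizations -/

section Factorization

variable {F : Type*} [NormedAddCommGroup F] [InnerProductSpace ℝ F] [CompleteSpace F]
  {E : Type*} [NormedAddCommGroup E] [InnerProductSpace ℝ E] [FiniteDimensional ℝ E]
  {ι : Type*} [Fintype ι] {J : E →L[ℝ] F} (u : OrthonormalBasis ι ℝ E) {τ : ι → ℝ}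

theorem inner_comp_adjoint_nonneg (J : E →L[ℝ] F) (f : F) :
    0 ≤ ⟪f, (J ∘L J.adjoint) f⟫_ℝ := by
  rw [ContinuousLinearMap.comp_apply, ← ContinuousLinearMap.adjoint_inner_left]
  exact real_inner_self_nonneg

theorem norm_sq_map_eq_sum (hu : ∀ j, J.adjoint (J (u j)) = τ j • u j) (v : E) :
    ‖J v‖ ^ 2 = ∑ j, τ j * ⟪u j, v⟫_ℝ ^ 2 := by
  rw [← real_inner_self_eq_norm_sq, ← ContinuousLinearMap.adjoint_inner_left,
    ← u.sum_inner_mul_inner]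
  refine Finset.sum_congr rfl fun j _ => ?_
  rw [ContinuousLinearMap.adjoint_inner_left, ← ContinuousLinearMap.adjoint_inner_right, hu,
    real_inner_smul_right, real_inner_comm]
  ring

theorem eigenvalue_nonneg (hu : ∀ j, J.adjoint (J (u j)) = τ j • u j) (j : ι) : 0 ≤ τ j := by
  have h : τ j = ‖J (u j)‖ ^ 2 := by
    rw [← real_inner_self_eq_norm_sq, ← ContinuousLinearMap.adjoint_inner_left, hu,
      real_inner_smul_left, real_inner_self_eq_norm_sq]
    simp
  rw [h]
  positivity

theorem norm_sq_resolvent_map (hu : ∀ j, J.adjoint (J (u j)) = τ j • u j) {lam : ℝ}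
    (hlam : 0 < lam) (v : E) :
    ‖resolvent (J ∘L J.adjoint) lam (J v)‖ ^ 2 =
      ∑ j, τ j * (⟪u j, v⟫_ℝ / (τ j + lam)) ^ 2 := by
  have hne : ∀ j, τ j + lam ≠ 0 := fun j => by linarith [eigenvalue_nonneg u hu j]
  set w : E := ∑ j, (⟪u j, v⟫_ℝ / (τ j + lam)) • u j with hw
  have h1 : J.adjoint (J w) + lam • w = v := by
    rw [hw, map_sum, map_sum, Finset.smul_sum, ← Finset.sum_add_distrib]
    conv_rhs => rw [← u.sum_repr' v]
    refine Finset.sum_congr rfl fun j _ => ?_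
    rw [map_smul, map_smul, hu, smul_smul, smul_smul, ← add_smul]
    congr 1
    field_simp [hne j]
  have h2 : J v = (J ∘L J.adjoint) (J w) + lam • J w := by
    rw [← h1]
    simp
  rw [h2, resolvent_add_apply (inner_comp_adjoint_nonneg J) hlam, norm_sq_map_eq_sum u hu]
  refine Finset.sum_congr rfl fun j _ => ?_
  rw [hw, inner_sum, Finset.sum_eq_single j]
  · rw [real_inner_smul_right, real_inner_self_eq_norm_sq, u.norm_eq_one]
    ring
  · intro k _ hk
    rw [real_inner_smul_right, u.inner_eq_zero hk.symm, mul_zero]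
  · simp

/-- The degrees of freedom of a finite-rank operator `J J*`, by Parseval's identity. -/
theorem trace_mul_resolvent (hu : ∀ j, J.adjoint (J (u j)) = τ j • u j) {lam : ℝ}
    (hlam : 0 < lam) :
    trace ((J ∘L J.adjoint) * resolvent (J ∘L J.adjoint) lam) = ∑ j, τ j / (τ j + lam) := by
  have hne : ∀ j, τ j + lam ≠ 0 := fun j => by linarith [eigenvalue_nonneg u hu j]
  obtain ⟨b, hb⟩ := (exists_hilbertBasis ℝ F).choose_spec
  have hcoord : ∀ (f : F) (j : ι), ⟪u j, J.adjoint (resolvent (J ∘L J.adjoint) lam f)⟫_ℝ =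
      ⟪J (u j), f⟫_ℝ / (τ j + lam) := by
    intro f j
    have h := add_resolvent_apply (inner_comp_adjoint_nonneg J) hlam f
    set x := resolvent (J ∘L J.adjoint) lam f
    rw [eq_div_iff (hne j), ← h, inner_add_right, real_inner_smul_right,
      ContinuousLinearMap.comp_apply,
      ← ContinuousLinearMap.adjoint_inner_left J (J.adjoint x) (J (u j)), hu,
      real_inner_smul_left, ContinuousLinearMap.adjoint_inner_right J (u j) x]
    ring
  have hterm : ∀ f : F, ⟪f, ((J ∘L J.adjoint) * resolvent (J ∘L J.adjoint) lam) f⟫_ℝ =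
      ∑ j, ⟪J (u j), f⟫_ℝ * ⟪f, J (u j)⟫_ℝ / (τ j + lam) := by
    intro f
    change ⟪f, J (J.adjoint (resolvent (J ∘L J.adjoint) lam f))⟫_ℝ = _
    rw [← ContinuousLinearMap.adjoint_inner_left, ← u.sum_inner_mul_inner]
    refine Finset.sum_congr rfl fun j _ => ?_
    rw [hcoord, ContinuousLinearMap.adjoint_inner_left, real_inner_comm f]
    ring
  have hsum : HasSum (fun e : (exists_hilbertBasis ℝ F).choose =>
      ⟪(e : F), ((J ∘L J.adjoint) * resolvent (J ∘L J.adjoint) lam) (e : F)⟫_ℝ)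
      (∑ j, τ j / (τ j + lam)) := by
    simp only [hterm]
    refine hasSum_sum fun j _ => ?_
    have h := (b.hasSum_inner_mul_inner (J (u j)) (J (u j))).div_const (τ j + lam)
    rw [hb] at h
    rwa [← ContinuousLinearMap.adjoint_inner_left, hu, real_inner_smul_left,
      real_inner_self_eq_norm_sq, u.norm_eq_one, one_pow, mul_one] at h
  exact hsum.tsum_eq

/-- Completing the square at the solution of the normal equations. -/
theorem norm_sq_sub_add_eq {lam : ℝ} {g : F} {th : E}
    (hth : J.adjoint (J th) + lam • th = J.adjoint g) (v : E) :
    ‖J v - g‖ ^ 2 + lam * ‖v‖ ^ 2 = ‖J th - g‖ ^ 2 + lam * ‖th‖ ^ 2 +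
      (‖J (v - th)‖ ^ 2 + lam * ‖v - th‖ ^ 2) := by
  have h0 : ⟪J (v - th), J th - g⟫_ℝ + lam * ⟪v - th, th⟫_ℝ = 0 := by
    rw [← ContinuousLinearMap.adjoint_inner_right, map_sub, ← hth, ← real_inner_smul_right,
      ← inner_add_right]
    simp
  have h1 : J v - g = J (v - th) + (J th - g) := by rw [map_sub]; abel
  have h2 : ‖v‖ ^ 2 = ‖(v - th) + th‖ ^ 2 := by rw [sub_add_cancel]
  rw [h1, h2, norm_add_sq_real, norm_add_sq_real]
  linarith

theorem exists_normal_eq (J : E →L[ℝ] F) {lam : ℝ} (hlam : 0 < lam) (g : F) :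
    ∃ th : E, J.adjoint (J th) + lam • th = J.adjoint g := by
  have hpos : ∀ v, 0 ≤ ⟪v, (J.adjoint ∘L J) v⟫_ℝ := by
    intro v
    rw [ContinuousLinearMap.comp_apply, ContinuousLinearMap.adjoint_inner_right]
    exact real_inner_self_nonneg
  exact ⟨resolvent (J.adjoint ∘L J) lam (J.adjoint g), add_resolvent_apply hpos hlam _⟩

/-- The solution of the normal equations is controlled by `f = (S + lam)⁻¹ g` for any operator
`S` close to `J J*` on `f`: compare it with the competitor `J* f`. -/
theorem norm_sq_normal_eq_le {lam : ℝ} (hlam : 0 < lam) {g f s : F} {th : E}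
    (hth : J.adjoint (J th) + lam • th = J.adjoint g) (hf : s + lam • f = g) :
    ‖th‖ ^ 2 ≤ ⟪f, g⟫_ℝ + 1 / lam * ‖J (J.adjoint f) - s‖ ^ 2 +
      ‖J (J.adjoint f) - s‖ * ‖f‖ := by
  have h1 := norm_sq_sub_add_eq hth (J.adjoint f)
  set Δ := J (J.adjoint f) - s with hΔ
  have h2 : J (J.adjoint f) - g = Δ - lam • f := by rw [hΔ, ← hf]; abel
  have h3 : ‖J.adjoint f‖ ^ 2 = ⟪f, Δ⟫_ℝ + ⟪f, g⟫_ℝ - lam * ‖f‖ ^ 2 := by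
    rw [← real_inner_self_eq_norm_sq, ContinuousLinearMap.adjoint_inner_left, hΔ, ← hf]
    simp only [inner_sub_right, inner_add_right, real_inner_smul_right,
      real_inner_self_eq_norm_sq]
    ring
  have h4 : ‖Δ - lam • f‖ ^ 2 = ‖Δ‖ ^ 2 - 2 * lam * ⟪f, Δ⟫_ℝ + lam ^ 2 * ‖f‖ ^ 2 := by
    rw [norm_sub_sq_real, real_inner_smul_right, norm_smul, mul_pow, Real.norm_eq_abs, sq_abs,
      real_inner_comm]
    ring
  rw [h2, h4, h3] at h1
  have h5 : -(‖Δ‖ * ‖f‖) ≤ ⟪f, Δ⟫_ℝ := by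
    have := (abs_le.1 (abs_real_inner_le_norm f Δ)).1
    rwa [mul_comm] at this
  have h6 : lam * ‖th‖ ^ 2 ≤
      lam * (⟪f, g⟫_ℝ + 1 / lam * ‖Δ‖ ^ 2 + ‖Δ‖ * ‖f‖) := by
    have e : lam * (⟪f, g⟫_ℝ + 1 / lam * ‖Δ‖ ^ 2 + ‖Δ‖ * ‖f‖) =
        lam * ⟪f, g⟫_ℝ + ‖Δ‖ ^ 2 + lam * (‖Δ‖ * ‖f‖) := by
      field_simp
    rw [e]
    have h7 := mul_le_mul_of_nonneg_left h5 hlam.le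
    have h8 : 0 ≤ ‖J (J.adjoint f - th)‖ ^ 2 + lam * ‖J.adjoint f - th‖ ^ 2 := by positivity
    have h9 := sq_nonneg ‖J th - g‖
    nlinarith
  exact le_of_mul_le_mul_left h6 hlam

end Factorization


/-! ### Reproducing kernel Hilbert spaces with a finite-dimensional feature map -/

section FeatureMap

variable {X : Type*} {H : Type*} [NormedAddCommGroup H] [InnerProductSpace ℝ H] [CompleteSpace H]
  [RKHS ℝ H X ℝ] {E : Type*} [NormedAddCommGroup E] [InnerProductSpace ℝ E]
  [FiniteDimensional ℝ E] {Φ : X → E}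

theorem kerFun_one_apply (hk : ∀ x x', RKHS.kernel H x x' 1 = ⟪Φ x, Φ x'⟫_ℝ) (x x' : X) :
    RKHS.kerFun H x' (1 : ℝ) x = ⟪Φ x, Φ x'⟫_ℝ := by
  rw [RKHS.kerFun_apply, hk]

theorem linearCombination_kerFun_apply (hk : ∀ x x', RKHS.kernel H x x' 1 = ⟪Φ x, Φ x'⟫_ℝ)
    (c : X →₀ ℝ) (x : X) :
    (Finsupp.linearCombination ℝ (fun x => RKHS.kerFun H x (1 : ℝ)) c : H) x =
      ⟪Φ x, Finsupp.linearCombination ℝ Φ c⟫_ℝ := by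
  induction c using Finsupp.induction_linear with
  | zero => simp
  | add f g hf hg => simp [hf, hg, inner_add_right]
  | single a b => simp [kerFun_one_apply hk, real_inner_smul_right]

theorem norm_linearCombination_kerFun (hk : ∀ x x', RKHS.kernel H x x' 1 = ⟪Φ x, Φ x'⟫_ℝ)
    (c : X →₀ ℝ) : ‖(Finsupp.linearCombination ℝ (fun x => RKHS.kerFun H x (1 : ℝ)) c : H)‖ =
      ‖Finsupp.linearCombination ℝ Φ c‖ := by
  have h : ∀ c' : X →₀ ℝ,
      ⟪(Finsupp.linearCombination ℝ (fun x => RKHS.kerFun H x (1 : ℝ)) c' : H),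
        Finsupp.linearCombination ℝ (fun x => RKHS.kerFun H x (1 : ℝ)) c⟫_ℝ =
      ⟪Finsupp.linearCombination ℝ Φ c', Finsupp.linearCombination ℝ Φ c⟫_ℝ := by
    intro c'
    induction c' using Finsupp.induction_linear with
    | zero => simp
    | add f g hf hg => simp only [map_add, inner_add_left, hf, hg]
    | single a b =>
      rw [Finsupp.linearCombination_single, Finsupp.linearCombination_single,
        real_inner_smul_left, real_inner_smul_left, RKHS.kerFun_inner,
        linearCombination_kerFun_apply hk]
      simp
  have h2 := h c
  rw [real_inner_self_eq_norm_sq, real_inner_self_eq_norm_sq] at h2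
  exact (sq_eq_sq₀ (norm_nonneg _) (norm_nonneg _)).1 h2

/-- Every element of the reproducing kernel Hilbert space is represented isometrically by a vector
of the feature space: the span of the kernel functions is dense and isometric to the span of
the features. -/
theorem exists_feature_repr (hk : ∀ x x', RKHS.kernel H x x' 1 = ⟪Φ x, Φ x'⟫_ℝ) (h : H) :
    ∃ θ : E, (∀ x, h x = ⟪Φ x, θ⟫_ℝ) ∧ ‖θ‖ = ‖h‖ := by
  set L := Finsupp.linearCombination ℝ (fun x => RKHS.kerFun H x (1 : ℝ)) with hL
  have hmem : h ∈ closure (LinearMap.range L : Set H) := by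
    have h1 : h ∈ Submodule.topologicalClosure
        (Submodule.span ℝ {RKHS.kerFun H x v | (x : X) (v : ℝ)}) := by
      rw [RKHS.kerFun_dense]
      trivial
    refine closure_mono ?_ h1
    change Submodule.span ℝ _ ≤ LinearMap.range L
    rw [Submodule.span_le]
    rintro _ ⟨x, v, rfl⟩
    refine ⟨Finsupp.single x v, ?_⟩
    rw [hL, Finsupp.linearCombination_single, ← map_smul]
    simp
  obtain ⟨s, hs, hlim⟩ := mem_closure_iff_seq_limit.1 hmem
  choose c hc using hs
  have hcauchy : CauchySeq fun n => Finsupp.linearCombination ℝ Φ (c n) := by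
    have h1 := hlim.cauchySeq
    rw [Metric.cauchySeq_iff] at h1 ⊢
    intro ε hε
    obtain ⟨N, hN⟩ := h1 ε hε
    refine ⟨N, fun m hm n hn => ?_⟩
    have h2 := hN m hm n hn
    rwa [← hc m, ← hc n, dist_eq_norm, ← map_sub, norm_linearCombination_kerFun hk, map_sub,
      ← dist_eq_norm] at h2
  obtain ⟨θ, hθ⟩ := cauchySeq_tendsto_of_complete hcauchy
  refine ⟨θ, fun x => ?_, ?_⟩
  · have h1 := ((RKHS.continuous_eval (H := H) x).tendsto h).comp hlim
    have h2 : Filter.Tendsto (fun n => ⟪Φ x, Finsupp.linearCombination ℝ Φ (c n)⟫_ℝ)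
        Filter.atTop (nhds ⟪Φ x, θ⟫_ℝ) := tendsto_const_nhds.inner hθ
    refine tendsto_nhds_unique h1 (h2.congr fun n => ?_)
    rw [Function.comp_apply, ← hc n, linearCombination_kerFun_apply hk]
  · refine tendsto_nhds_unique hθ.norm (hlim.norm.congr fun n => ?_)
    rw [← hc n, norm_linearCombination_kerFun hk]

/-- Every linear function of the features belongs to the reproducing kernel Hilbert space: only
the projection of the vector to the span of the features matters. -/
theorem exists_of_feature (hk : ∀ x x', RKHS.kernel H x x' 1 = ⟪Φ x, Φ x'⟫_ℝ) (θ : E) :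
    ∃ h : H, (∀ x, h x = ⟪Φ x, θ⟫_ℝ) ∧ ‖h‖ ≤ ‖θ‖ := by
  set V := LinearMap.range (Finsupp.linearCombination ℝ Φ) with hV
  obtain ⟨c, hc⟩ : V.starProjection θ ∈ V := Submodule.starProjection_apply_mem _ _
  refine ⟨Finsupp.linearCombination ℝ (fun x => RKHS.kerFun H x (1 : ℝ)) c, fun x => ?_, ?_⟩
  · have hx : Φ x ∈ V := ⟨Finsupp.single x 1, by simp⟩
    rw [linearCombination_kerFun_apply hk, hc, ← Submodule.inner_starProjection_left_eq_right,
      Submodule.starProjection_eq_self_iff.2 hx]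
  · rw [norm_linearCombination_kerFun hk, hc]
    exact Submodule.norm_starProjection_apply_le _ _

/-- Stochastic gradient descent in the reproducing kernel Hilbert space is least-mean-squares in
the feature space. -/
theorem refSGD_apply (hk : ∀ x x', RKHS.kernel H x x' 1 = ⟪Φ x, Φ x'⟫_ℝ) (η lam : ℝ)
    (z : ℕ → X × ℝ) (t : ℕ) (x : X) :
    refSGD H η lam z t x = ⟪Φ x, lms (fun p : X × ℝ => Φ p.1) Prod.snd η lam z t⟫_ℝ := by
  induction t generalizing x with
  | zero => simp [refSGD, lms]
  | succ t ih =>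
    simp only [refSGD, lms, RKHS.coe_sub, RKHS.coe_smul, Pi.sub_apply, Pi.smul_apply, ih,
      smul_eq_mul, inner_sub_right, real_inner_smul_right, kerFun_one_apply hk]

theorem refASGD_apply (hk : ∀ x x', RKHS.kernel H x x' 1 = ⟪Φ x, Φ x'⟫_ℝ) (η lam : ℝ)
    (z : ℕ → X × ℝ) (n : ℕ) (x : X) :
    refASGD H η lam z n x = ⟪Φ x, (1 / ((n : ℝ) + 1)) • ∑ t ∈ Finset.range (n + 1),
      lms (fun p : X × ℝ => Φ p.1) Prod.snd η lam z t⟫_ℝ := by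
  have hsum : ∀ s : Finset ℕ, (∑ t ∈ s, refSGD H η lam z t) x =
      ∑ t ∈ s, refSGD H η lam z t x := by
    classical
    intro s
    induction s using Finset.induction_on with
    | empty => simp
    | insert a s ha ih => rw [Finset.sum_insert ha, Finset.sum_insert ha, RKHS.coe_add,
        Pi.add_apply, ih]
  rw [refASGD, RKHS.coe_smul, Pi.smul_apply, hsum, real_inner_smul_right, inner_sum, smul_eq_mul]
  simp only [refSGD_apply hk]

end FeatureMap

/-! ### The feature map as an operator to `L²` -/

section FeatureOp

variable {X : Type*} [MeasurableSpace X] {μ : Measure X}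
  {E : Type*} [NormedAddCommGroup E] [InnerProductSpace ℝ E] [FiniteDimensional ℝ E]
  {Φ : X → E}

/-- The operator which maps a vector `v` of the feature space to the function
`x ↦ ⟪Φ x, v⟫` in `L²(μ)`. -/
def featureOp (hΦ : MemLp Φ 2 μ) : E →L[ℝ] Lp ℝ 2 μ :=
  LinearMap.toContinuousLinearMap
    { toFun := fun v => (hΦ.inner_const v).toLp (fun x => ⟪Φ x, v⟫_ℝ)
      map_add' := by
        intro v w
        rw [← MemLp.toLp_add]
        exact MemLp.toLp_congr _ _ (.of_forall fun x => by simp [inner_add_right])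
      map_smul' := by
        intro c v
        rw [RingHom.id_apply, ← MemLp.toLp_const_smul]
        exact MemLp.toLp_congr _ _ (.of_forall fun x => by simp [real_inner_smul_right]) }

theorem featureOp_coeFn (hΦ : MemLp Φ 2 μ) (v : E) :
    featureOp hΦ v =ᵐ[μ] fun x => ⟪Φ x, v⟫_ℝ := (hΦ.inner_const v).coeFn_toLp

theorem toL2_eq_featureOp (hΦ : MemLp Φ 2 μ) (v : E) {f : X → ℝ} (hf : ∀ x, f x = ⟪Φ x, v⟫_ℝ) :
    toL2 μ f = featureOp hΦ v := by
  obtain rfl : f = fun x => ⟪Φ x, v⟫_ℝ := funext hf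
  exact dif_pos (hΦ.inner_const v)

theorem inner_featureOp_left (hΦ : MemLp Φ 2 μ) (v : E) (f : Lp ℝ 2 μ) :
    ⟪featureOp hΦ v, f⟫_ℝ = ∫ x, ⟪Φ x, v⟫_ℝ * f x ∂μ := by
  rw [L2.inner_def]
  refine integral_congr_ae ?_
  filter_upwards [featureOp_coeFn hΦ v] with x hx
  simp [hx, mul_comm]

theorem inner_featureOp_featureOp (hΦ : MemLp Φ 2 μ) (v w : E) :
    ⟪featureOp hΦ v, featureOp hΦ w⟫_ℝ = ∫ x, ⟪Φ x, v⟫_ℝ * ⟪Φ x, w⟫_ℝ ∂μ := by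
  rw [inner_featureOp_left]
  refine integral_congr_ae ?_
  filter_upwards [featureOp_coeFn hΦ w] with x hx
  simp [hx]

theorem integralOp_coeFn [SFinite μ] {k : X → X → ℝ}
    (hk : MemLp (Function.uncurry k) 2 (μ.prod μ)) (f : Lp ℝ 2 μ) :
    integralOp μ k f =ᵐ[μ] fun x => ∫ y, k x y * f y ∂μ := by
  rw [integralOp, dif_pos hk]
  exact integralOpOfMemLp_apply k hk f

theorem integralOp_congr [SFinite μ] {k k' : X → X → ℝ}
    (hk : MemLp (Function.uncurry k) 2 (μ.prod μ))
    (h : Function.uncurry k =ᵐ[μ.prod μ] Function.uncurry k') :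
    integralOp μ k = integralOp μ k' := by
  ext1 f
  refine Lp.ext ?_
  filter_upwards [integralOp_coeFn hk f, integralOp_coeFn (hk.ae_eq h) f,
    Measure.ae_ae_of_ae_prod h] with x h1 h2 h3
  rw [h1, h2]
  refine integral_congr_ae ?_
  filter_upwards [h3] with y hy
  rw [show k x y = k' x y from hy]

/-- The integral operator of a kernel with feature map `Φ` factors through the feature space. -/
theorem integralOp_eq_comp_adjoint [SFinite μ] {k : X → X → ℝ}
    (hk : MemLp (Function.uncurry k) 2 (μ.prod μ)) (hΦ : MemLp Φ 2 μ)
    (hkΦ : ∀ x y, k x y = ⟪Φ x, Φ y⟫_ℝ) :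
    integralOp μ k = featureOp hΦ ∘L (featureOp hΦ).adjoint := by
  ext1 f
  refine Lp.ext ?_
  filter_upwards [integralOp_coeFn hk f, featureOp_coeFn hΦ ((featureOp hΦ).adjoint f)]
    with x h1 h2
  rw [h1, ContinuousLinearMap.comp_apply, h2, ContinuousLinearMap.adjoint_inner_right,
    inner_featureOp_left]
  simp only [hkΦ, real_inner_comm]

end FeatureOp

/-! ### The risk in terms of the regression function -/

section Risk

variable {X : Type*} [MeasurableSpace X] {ρ : Measure (X × ℝ)} [IsProbabilityMeasure ρ]

theorem integral_mul_label (h : X → ℝ) (hint : Integrable (fun p : X × ℝ => h p.1 * p.2) ρ) :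
    ∫ p, h p.1 * p.2 ∂ρ = ∫ x, h x * bayes ρ x ∂ρ.fst := by
  have hd : ρ.fst.compProd ρ.condKernel = ρ := ρ.disintegrate ρ.condKernel
  calc ∫ p, h p.1 * p.2 ∂ρ = ∫ p, h p.1 * p.2 ∂(ρ.fst.compProd ρ.condKernel) := by rw [hd]
    _ = ∫ x, ∫ y, h x * y ∂(ρ.condKernel x) ∂ρ.fst :=
        Measure.integral_compProd (by rwa [hd])
    _ = ∫ x, h x * bayes ρ x ∂ρ.fst :=
        integral_congr_ae (.of_forall fun x => integral_const_mul (h x) fun y => y)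

theorem integrable_mul_label {h : X → ℝ} (hh : MemLp h 2 ρ.fst)
    (hY : ∀ᵐ p ∂ρ, p.2 ∈ Icc (-1 : ℝ) 1) : Integrable (fun p : X × ℝ => h p.1 * p.2) ρ := by
  have hfst : MeasurePreserving (Prod.fst : X × ℝ → X) ρ ρ.fst := ⟨measurable_fst, rfl⟩
  have h1 : Integrable (fun p : X × ℝ => h p.1) ρ :=
    hfst.integrable_comp_of_integrable (hh.integrable one_le_two)
  refine h1.mul_bdd (c := 1) measurable_snd.aestronglyMeasurable ?_
  filter_upwards [hY] with p hp
  exact abs_le.2 hp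

/-- Bias-variance decomposition of the risk. -/
theorem risk_eq {h : X → ℝ} (f g : Lp ℝ 2 ρ.fst) (hf : f =ᵐ[ρ.fst] h)
    (hg : g =ᵐ[ρ.fst] bayes ρ) (hY : ∀ᵐ p ∂ρ, p.2 ∈ Icc (-1 : ℝ) 1) :
    risk ρ h = 1 / 2 * ‖f - g‖ ^ 2 + (1 / 2 * ∫ p, p.2 ^ 2 ∂ρ - 1 / 2 * ‖g‖ ^ 2) := by
  have hfst : MeasurePreserving (Prod.fst : X × ℝ → X) ρ ρ.fst := ⟨measurable_fst, rfl⟩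
  have hh : MemLp h 2 ρ.fst := (Lp.memLp f).ae_eq hf
  have i1 : Integrable (fun p : X × ℝ => h p.1 ^ 2) ρ :=
    hfst.integrable_comp_of_integrable hh.integrable_sq
  have i2 := integrable_mul_label hh hY
  have i3 : Integrable (fun p : X × ℝ => p.2 ^ 2) ρ := by
    refine Integrable.of_bound (measurable_snd.pow_const 2).aestronglyMeasurable 1 ?_
    filter_upwards [hY] with p hp
    rw [norm_pow]
    exact pow_le_one₀ (norm_nonneg _) (abs_le.2 hp)
  have e1 : ∫ p, h p.1 ^ 2 ∂ρ = ‖f‖ ^ 2 := by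
    have h1 : ∫ p, h p.1 ^ 2 ∂ρ = ∫ x, h x ^ 2 ∂ρ.fst :=
      (integral_map measurable_fst.aemeasurable hh.integrable_sq.1).symm
    rw [h1, ← real_inner_self_eq_norm_sq, L2.inner_def]
    refine integral_congr_ae ?_
    filter_upwards [hf] with x hx
    simp [hx, pow_two]
  have e2 : ∫ p, h p.1 * p.2 ∂ρ = ⟪f, g⟫_ℝ := by
    rw [integral_mul_label h i2, L2.inner_def]
    refine integral_congr_ae ?_
    filter_upwards [hf, hg] with x hx hx'
    simp [hx, hx', mul_comm]
  have e3 : risk ρ h = 1 / 2 * ∫ p, h p.1 ^ 2 ∂ρ - ∫ p, h p.1 * p.2 ∂ρ +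
      1 / 2 * ∫ p, p.2 ^ 2 ∂ρ := by
    rw [risk, ← integral_const_mul, ← integral_const_mul,
      ← integral_sub (i1.const_mul _) i2, ← integral_add (by exact (i1.const_mul _).sub i2)
        (i3.const_mul _)]
    exact integral_congr_ae (.of_forall fun p => by ring)
  rw [e3, e1, e2, norm_sub_sq_real]
  ring

end Risk


/-! ### Monte Carlo approximation of integral operators -/

section MonteCarlo

variable {Ω : Type*} [MeasurableSpace Ω] {P : Measure Ω} [IsProbabilityMeasure P]

/-- The empirical mean of `m` independent bounded variables has variance at most `A² / m`. -/
theorem integral_sq_average_sub_le {φ : Ω → ℝ} (hφ : Measurable φ) {A : ℝ}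
    (hA : ∀ b, |φ b| ≤ A) {m : ℕ} (hm : 0 < m) :
    ∫ w, (1 / (m : ℝ) * ∑ r, φ (w r) - ∫ b, φ b ∂P) ^ 2 ∂(Measure.pi fun _ : Fin m => P) ≤
      A ^ 2 / m := by
  have hm' : (0 : ℝ) < m := by exact_mod_cast hm
  have bφ : BddMeas φ := ⟨hφ, A, hA⟩
  have hmem : MemLp φ 2 P := MemLp.of_bound hφ.aestronglyMeasurable A (.of_forall hA)
  have h1 := ProbabilityTheory.variance_sum_pi (μ := fun _ : Fin m => P)
    (X := fun _ : Fin m => φ) (fun _ => hmem)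
  have beval : ∀ r : Fin m, BddMeas (fun w : Fin m → Ω => φ (w r)) :=
    fun r => bφ.comp (measurable_pi_apply r)
  have hmeval : ∀ r : Fin m, ∫ w, φ (w r) ∂(Measure.pi fun _ : Fin m => P) = ∫ b, φ b ∂P := by
    intro r
    have hmp := measurePreserving_eval (fun _ : Fin m => P) r
    have h := integral_map hmp.measurable.aemeasurable
      (hφ.aestronglyMeasurable (μ := Measure.map (Function.eval r) (Measure.pi fun _ => P)))
    rw [hmp.map_eq] at h
    exact h.symm
  have hmean : ∫ w, (∑ r, fun w : Fin m → Ω => φ (w r)) w ∂(Measure.pi fun _ : Fin m => P) =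
      m * ∫ b, φ b ∂P := by
    simp only [Finset.sum_apply]
    rw [integral_finsetSum _ fun r _ => (beval r).integrable _]
    simp [hmeval]
  have hsm : AEMeasurable (∑ r, fun w : Fin m → Ω => φ (w r)) (Measure.pi fun _ : Fin m => P) := by
    have := (BddMeas.sum Finset.univ fun r _ => beval r).1.aemeasurable
      (μ := Measure.pi fun _ : Fin m => P)
    refine this.congr (.of_forall fun w => ?_)
    simp
  rw [ProbabilityTheory.variance_eq_integral hsm, hmean] at h1
  have hvar : ProbabilityTheory.variance φ P ≤ A ^ 2 := by
    refine (ProbabilityTheory.variance_le_expectation_sq hφ.aestronglyMeasurable).trans ?_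
    have h := integral_mono (bφ.sq.integrable P) (integrable_const (A ^ 2))
      (fun b => by
        change φ b ^ 2 ≤ A ^ 2
        rw [← sq_abs]
        exact pow_le_pow_left₀ (abs_nonneg _) (hA b) 2)
    simpa using h
  have hexp : ∀ w : Fin m → Ω, (1 / (m : ℝ) * ∑ r, φ (w r) - ∫ b, φ b ∂P) ^ 2 =
      1 / (m : ℝ) ^ 2 * ((∑ r, fun w : Fin m → Ω => φ (w r)) w - m * ∫ b, φ b ∂P) ^ 2 := by
    intro w
    rw [Finset.sum_apply]
    field_simp
  simp only [hexp]
  rw [integral_const_mul, h1]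
  simp only [Finset.sum_const, Finset.card_univ, Fintype.card_fin, nsmul_eq_mul]
  calc 1 / (m : ℝ) ^ 2 * (m * ProbabilityTheory.variance φ P)
      = ProbabilityTheory.variance φ P / m := by field_simp
    _ ≤ A ^ 2 / m := by gcongr

variable {X : Type*} [MeasurableSpace X] {μ : Measure X} [IsProbabilityMeasure μ]
  {κ : Ω → X → X → ℝ}

/-- The empirical mean of a random kernel. -/
def empKernel (κ : Ω → X → X → ℝ) {m : ℕ} (w : Fin m → Ω) (x y : X) : ℝ :=
  1 / (m : ℝ) * ∑ r, κ (w r) x y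

/-- The expectation of a random kernel. -/
def meanKernel (P : Measure Ω) (κ : Ω → X → X → ℝ) (x y : X) : ℝ := ∫ b, κ b x y ∂P

/-- The error, at `x`, of the Monte Carlo approximation of the integral of the mean kernel
against `f`. -/
def mcError (P : Measure Ω) (μ : Measure X) (κ : Ω → X → X → ℝ) (f : X → ℝ) {m : ℕ}
    (w : Fin m → Ω) (x : X) : ℝ :=
  1 / (m : ℝ) * ∑ r, (∫ y, κ (w r) x y * f y ∂μ) - ∫ b, ∫ y, κ b x y * f y ∂μ ∂P

theorem BddMeas.empKernel (hκ : BddMeas fun q : Ω × X × X => κ q.1 q.2.1 q.2.2) {m : ℕ}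
    (w : Fin m → Ω) : BddMeas (Function.uncurry (empKernel κ w)) :=
  (bddMeas_const _).mul (BddMeas.sum _ fun r _ =>
    hκ.comp (g := fun q : X × X => (w r, q)) (measurable_const.prodMk measurable_id))

theorem BddMeas.integral_snd {Y : Type*} [MeasurableSpace Y] {g : Y → Ω → ℝ}
    (hg : BddMeas (Function.uncurry g)) : BddMeas fun y => ∫ b, g y b ∂P := by
  obtain ⟨h1, C, hC⟩ := hg
  refine ⟨(h1.stronglyMeasurable.integral_prod_right').measurable, C, fun y => ?_⟩
  have h := norm_integral_le_of_norm_le_const (μ := P) (f := g y) (C := C)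
    (.of_forall fun b => hC (y, b))
  simpa using h

theorem BddMeas.meanKernel (hκ : BddMeas fun q : Ω × X × X => κ q.1 q.2.1 q.2.2) :
    BddMeas (Function.uncurry (meanKernel P κ)) :=
  BddMeas.integral_snd (g := fun (q : X × X) b => κ b q.1 q.2)
    (hκ.comp (g := fun p : (X × X) × Ω => (p.2, p.1))
      (measurable_snd.prodMk measurable_fst))

theorem BddMeas.memLp_two {Y : Type*} [MeasurableSpace Y] {f : Y → ℝ} (hf : BddMeas f)
    (ν : Measure Y) [IsFiniteMeasure ν] : MemLp f 2 ν :=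
  MemLp.of_bound hf.1.aestronglyMeasurable hf.2.choose (.of_forall hf.2.choose_spec)

theorem integrable_bdd_mul {f g : X → ℝ} (hf : Integrable f μ) (hg : BddMeas g) :
    Integrable (fun y => g y * f y) μ :=
  hf.bdd_mul (c := hg.2.choose) hg.1.aestronglyMeasurable (.of_forall hg.2.choose_spec)

theorem bddMeas_integral_kernel (hκ : BddMeas fun q : Ω × X × X => κ q.1 q.2.1 q.2.2)
    (f : Lp ℝ 2 μ) : BddMeas (fun q : Ω × X => ∫ y, κ q.1 q.2 y * f y ∂μ) := by
  have hfi : Integrable f μ := (Lp.memLp f).integrable one_le_two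
  refine ⟨?_, ?_⟩
  · have h1 : Measurable fun p : (Ω × X) × X => κ p.1.1 p.1.2 p.2 * f p.2 :=
      (hκ.comp (g := fun p : (Ω × X) × X => (p.1.1, p.1.2, p.2))
        (by fun_prop)).1.mul ((Lp.stronglyMeasurable f).measurable.comp measurable_snd)
    exact (h1.stronglyMeasurable.integral_prod_right' (ν := μ)).measurable
  · obtain ⟨-, C, hC⟩ := hκ
    refine ⟨∫ y, C * |f y| ∂μ, fun q => ?_⟩
    refine norm_integral_le_of_norm_le (hfi.abs.const_mul C) (.of_forall fun y => ?_)
    rw [norm_mul]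
    exact mul_le_mul_of_nonneg_right (hC (q.1, q.2, y)) (norm_nonneg _)

theorem bddMeas_mcError (hκ : BddMeas fun q : Ω × X × X => κ q.1 q.2.1 q.2.2)
    (f : Lp ℝ 2 μ) (m : ℕ) :
    BddMeas (fun q : (Fin m → Ω) × X => mcError P μ κ f q.1 q.2) := by
  have hψ := bddMeas_integral_kernel hκ f
  refine BddMeas.sub ((bddMeas_const _).mul (BddMeas.sum _ fun r _ => ?_)) ?_
  · exact hψ.comp (g := fun q : (Fin m → Ω) × X => (q.1 r, q.2)) (by fun_prop)
  · refine BddMeas.comp (f := fun x => ∫ b, ∫ y, κ b x y * f y ∂μ ∂P) ?_ measurable_snd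
    exact BddMeas.integral_snd (g := fun x b => ∫ y, κ b x y * f y ∂μ)
      (hψ.comp (g := fun p : X × Ω => (p.2, p.1)) (by fun_prop))

theorem integralOp_emp_sub_mean (hκ : BddMeas fun q : Ω × X × X => κ q.1 q.2.1 q.2.2)
    (f : Lp ℝ 2 μ) {m : ℕ} (w : Fin m → Ω) :
    (integralOp μ (empKernel κ w) f - integralOp μ (meanKernel P κ) f : Lp ℝ 2 μ) =ᵐ[μ]
      mcError P μ κ f w := by
  have hfi : Integrable f μ := (Lp.memLp f).integrable one_le_two
  filter_upwards [Lp.coeFn_sub (integralOp μ (empKernel κ w) f)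
      (integralOp μ (meanKernel P κ) f),
    integralOp_coeFn ((hκ.empKernel w).memLp_two (μ.prod μ)) f,
    integralOp_coeFn ((hκ.meanKernel (P := P)).memLp_two (μ.prod μ)) f] with x h1 h2 h3
  rw [h1, Pi.sub_apply, h2, h3, mcError]
  congr 1
  · simp only [empKernel, mul_assoc, Finset.sum_mul]
    rw [integral_const_mul, integral_finsetSum]
    intro r _
    exact integrable_bdd_mul hfi
      (hκ.comp (g := fun y => (w r, x, y)) (by fun_prop))
  · simp only [meanKernel, ← integral_mul_const]
    refine integral_integral_swap (f := fun y b => κ b x y * f y) ?_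
    have hf2 : Integrable (fun p : X × Ω => f p.1) (μ.prod P) := hfi.comp_fst P
    exact integrable_bdd_mul (μ := μ.prod P) hf2
      (hκ.comp (g := fun p : X × Ω => (p.2, x, p.1)) (by fun_prop))

theorem norm_sq_emp_sub_mean (hκ : BddMeas fun q : Ω × X × X => κ q.1 q.2.1 q.2.2)
    (f : Lp ℝ 2 μ) {m : ℕ} (w : Fin m → Ω) :
    ‖integralOp μ (empKernel κ w) f - integralOp μ (meanKernel P κ) f‖ ^ 2 =
      ∫ x, mcError P μ κ f w x ^ 2 ∂μ := by
  rw [← real_inner_self_eq_norm_sq, L2.inner_def]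
  refine integral_congr_ae ?_
  filter_upwards [integralOp_emp_sub_mean (P := P) hκ f w] with x hx
  simp only [hx]
  simp [pow_two]

theorem bddMeas_norm_sq_emp_sub_mean (hκ : BddMeas fun q : Ω × X × X => κ q.1 q.2.1 q.2.2)
    (f : Lp ℝ 2 μ) (m : ℕ) : BddMeas fun w : Fin m → Ω =>
      ‖integralOp μ (empKernel κ w) f - integralOp μ (meanKernel P κ) f‖ ^ 2 := by
  simp only [norm_sq_emp_sub_mean hκ f]
  exact BddMeas.integral_snd (g := fun (w : Fin m → Ω) x => mcError P μ κ f w x ^ 2)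
    (bddMeas_mcError hκ f m).sq

/-- The mean square error of the Monte Carlo approximation of an integral operator decays like
`1 / m`. -/
theorem exists_integral_norm_sq_emp_sub_mean_le
    (hκ : BddMeas fun q : Ω × X × X => κ q.1 q.2.1 q.2.2) (f : Lp ℝ 2 μ) :
    ∃ A : ℝ, ∀ m : ℕ, 0 < m →
      ∫ w, ‖integralOp μ (empKernel κ w) f - integralOp μ (meanKernel P κ) f‖ ^ 2
        ∂(Measure.pi fun _ : Fin m => P) ≤ A / m := by
  obtain ⟨hψm, A, hA⟩ := bddMeas_integral_kernel hκ f
  refine ⟨A ^ 2, fun m hm => ?_⟩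
  have hsq := (bddMeas_mcError (P := P) hκ f m).sq
  simp only [norm_sq_emp_sub_mean hκ f]
  rw [integral_integral_swap (f := fun (w : Fin m → Ω) x => mcError P μ κ f w x ^ 2)
    (hsq.integrable _)]
  have h : ∀ x, ∫ w, mcError P μ κ f w x ^ 2 ∂(Measure.pi fun _ : Fin m => P) ≤ A ^ 2 / m :=
    fun x => integral_sq_average_sub_le (φ := fun b => ∫ y, κ b x y * f y ∂μ)
      (hψm.comp (f := fun b : Ω => (b, x)) (by fun_prop)) (fun b => hA (b, x)) hm
  have h2 := integral_mono
    (hsq.integrable ((Measure.pi fun _ : Fin m => P).prod μ)).integral_prod_right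
    (integrable_const (A ^ 2 / m)) h
  simpa using h2

theorem exists_event_norm_emp_sub_mean_le
    (hκ : BddMeas fun q : Ω × X × X => κ q.1 q.2.1 q.2.2) (f : Lp ℝ 2 μ) {ε δ : ℝ}
    (hε : 0 < ε) (hδ : 0 < δ) :
    ∃ m₀ : ℕ, ∀ m : ℕ, m₀ ≤ m → 0 < m → ∃ Ev : Set (Fin m → Ω), MeasurableSet Ev ∧
      ENNReal.ofReal (1 - δ) ≤ Measure.pi (fun _ : Fin m => P) Ev ∧
      ∀ w ∈ Ev, ‖integralOp μ (empKernel κ w) f - integralOp μ (meanKernel P κ) f‖ ≤ ε := by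
  obtain ⟨A, hA⟩ := exists_integral_norm_sq_emp_sub_mean_le (P := P) hκ f
  obtain ⟨m₀, hm₀⟩ := exists_nat_ge (A / (ε ^ 2 * δ))
  refine ⟨m₀, fun m hm hm0 => ?_⟩
  have hm' : (0 : ℝ) < m := by exact_mod_cast hm0
  set Q := Measure.pi fun _ : Fin m => P
  set N : (Fin m → Ω) → ℝ := fun w =>
    ‖integralOp μ (empKernel κ w) f - integralOp μ (meanKernel P κ) f‖ ^ 2 with hN
  have hNm : BddMeas N := bddMeas_norm_sq_emp_sub_mean hκ f m
  have hEv : MeasurableSet {w | ε ^ 2 ≤ N w} := measurableSet_le measurable_const hNm.1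
  refine ⟨{w | ε ^ 2 ≤ N w}ᶜ, hEv.compl, ?_, fun w hw => ?_⟩
  · have hmk := mul_meas_ge_le_integral_of_nonneg (μ := Q)
      (.of_forall fun w => sq_nonneg _ : 0 ≤ᵐ[Q] N) (hNm.integrable Q) (ε ^ 2)
    have h1 : A / m ≤ ε ^ 2 * δ := by
      have h2 : A / (ε ^ 2 * δ) ≤ m := hm₀.trans (by exact_mod_cast hm)
      rw [div_le_iff₀ (by positivity)] at h2
      rw [div_le_iff₀ hm']
      linarith
    have h3 : Q.real {w | ε ^ 2 ≤ N w} ≤ δ := by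
      have h4 := hmk.trans ((hA m hm0).trans h1)
      exact le_of_mul_le_mul_left h4 (by positivity)
    rw [← ofReal_measureReal, probReal_compl_eq_one_sub hEv]
    exact ENNReal.ofReal_le_ofReal (by linarith)
  · have h1 : N w < ε ^ 2 := not_le.1 hw
    exact (lt_of_pow_lt_pow_left₀ 2 hε.le h1).le

/-- Any two functions admit samples along which the Monte Carlo approximations of the integral
operator converge at both of them. -/
theorem exists_tendsto_emp (hκ : BddMeas fun q : Ω × X × X => κ q.1 q.2.1 q.2.2)
    (f g : Lp ℝ 2 μ) :
    ∃ w : ∀ m : ℕ, Fin (m + 1) → Ω,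
      Filter.Tendsto (fun m => integralOp μ (empKernel κ (w m)) f) Filter.atTop
        (nhds (integralOp μ (meanKernel P κ) f)) ∧
      Filter.Tendsto (fun m => integralOp μ (empKernel κ (w m)) g) Filter.atTop
        (nhds (integralOp μ (meanKernel P κ) g)) := by
  obtain ⟨A, hA⟩ := exists_integral_norm_sq_emp_sub_mean_le (P := P) hκ f
  obtain ⟨B, hB⟩ := exists_integral_norm_sq_emp_sub_mean_le (P := P) hκ g
  have hex : ∀ m : ℕ, ∃ w : Fin (m + 1) → Ω,
      ‖integralOp μ (empKernel κ w) f - integralOp μ (meanKernel P κ) f‖ ^ 2 +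
        ‖integralOp μ (empKernel κ w) g - integralOp μ (meanKernel P κ) g‖ ^ 2 ≤
      (A + B) / ((m : ℝ) + 1) := by
    intro m
    have bf := bddMeas_norm_sq_emp_sub_mean (P := P) hκ f (m + 1)
    have bg := bddMeas_norm_sq_emp_sub_mean (P := P) hκ g (m + 1)
    obtain ⟨w, hw⟩ := exists_le_integral (μ := Measure.pi fun _ : Fin (m + 1) => P)
      ((bf.add bg).integrable _)
    refine ⟨w, hw.trans ?_⟩
    rw [integral_add (bf.integrable _) (bg.integrable _), add_div]
    have h1 := hA (m + 1) (Nat.succ_pos m)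
    have h2 := hB (m + 1) (Nat.succ_pos m)
    push_cast at h1 h2
    exact add_le_add h1 h2
  choose w hw using hex
  have hlim : Filter.Tendsto (fun m : ℕ => √((A + B) / ((m : ℝ) + 1))) Filter.atTop (nhds 0) := by
    have h1 : Filter.Tendsto (fun m : ℕ => (A + B) * (1 / ((m : ℝ) + 1))) Filter.atTop
        (nhds ((A + B) * 0)) := tendsto_one_div_add_atTop_nhds_zero_nat.const_mul _
    have h2 := (Real.continuous_sqrt.tendsto _).comp h1
    simpa [Function.comp_def, div_eq_mul_inv] using h2
  refine ⟨w, ?_, ?_⟩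
  · refine tendsto_iff_norm_sub_tendsto_zero.2 (squeeze_zero (fun _ => norm_nonneg _)
      (fun m => Real.le_sqrt_of_sq_le ?_) hlim)
    linarith [hw m, sq_nonneg
      ‖integralOp μ (empKernel κ (w m)) g - integralOp μ (meanKernel P κ) g‖]
  · refine tendsto_iff_norm_sub_tendsto_zero.2 (squeeze_zero (fun _ => norm_nonneg _)
      (fun m => Real.le_sqrt_of_sq_le ?_) hlim)
    linarith [hw m, sq_nonneg
      ‖integralOp μ (empKernel κ (w m)) f - integralOp μ (meanKernel P κ) f‖]

end MonteCarlo


/-! ### Averaged stochastic gradient descent in the Hilbert space -/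

section AveragedSGD

variable {X : Type*} [MeasurableSpace X] {ρ : Measure (X × ℝ)} [IsProbabilityMeasure ρ]
  {E : Type*} [NormedAddCommGroup E] [InnerProductSpace ℝ E] [FiniteDimensional ℝ E]
  [MeasurableSpace E] [BorelSpace E] {Φ : X → E} {R lam η : ℝ} {g : Lp ℝ 2 ρ.fst} {th : E}

open Classical in
/-- The features of a sample, set to zero where they are larger than allowed. They are bounded
only almost surely, and the truncation makes the iterates bounded everywhere without changing
them almost surely. -/
def truncFeature (Φ : X → E) (R : ℝ) (p : X × ℝ) : E := if ‖Φ p.1‖ ^ 2 ≤ R then Φ p.1 else 0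

open Classical in
/-- The label of a sample, set to zero outside `[-1, 1]`. -/
def truncLabel (p : X × ℝ) : ℝ := if p.2 ∈ Icc (-1 : ℝ) 1 then p.2 else 0

theorem lms_congr {Z : Type*} {Φ Φ' : Z → E} {y y' : Z → ℝ} {z : ℕ → Z}
    (h : ∀ t, Φ (z t) = Φ' (z t) ∧ y (z t) = y' (z t)) (t : ℕ) :
    lms Φ y η lam z t = lms Φ' y' η lam z t := by
  induction t with
  | zero => rfl
  | succ t ih => rw [lms, lms, ih, (h t).1, (h t).2]

theorem ae_truncFeature (hR : ∀ᵐ p ∂ρ, ‖Φ p.1‖ ^ 2 ≤ R) :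
    ∀ᵐ p ∂ρ, Φ p.1 = truncFeature Φ R p := by
  filter_upwards [hR] with p hp
  rw [truncFeature, if_pos hp]

theorem ae_truncLabel (hY : ∀ᵐ p ∂ρ, p.2 ∈ Icc (-1 : ℝ) 1) : ∀ᵐ p ∂ρ, p.2 = truncLabel p := by
  filter_upwards [hY] with p hp
  rw [truncLabel, if_pos hp]

/-- The truncated features and labels satisfy the hypotheses of the least-mean-squares bound with
the covariance operator `J* J`, where `J` maps a vector to its function in `L²`. -/
theorem lmsData_trunc (hm : Measurable Φ) (hΦ : MemLp Φ 2 ρ.fst) (hR0 : 0 ≤ R)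
    (hR : ∀ᵐ p ∂ρ, ‖Φ p.1‖ ^ 2 ≤ R) (hY : ∀ᵐ p ∂ρ, p.2 ∈ Icc (-1 : ℝ) 1)
    (hg : g =ᵐ[ρ.fst] bayes ρ)
    (hth : (featureOp hΦ).adjoint (featureOp hΦ th) + lam • th = (featureOp hΦ).adjoint g)
    (hlam : 0 < lam) (hη : 0 < η) (hstep : η * (R + lam) ≤ 1 / 2) :
    LMSData ρ (truncFeature Φ R) truncLabel ((featureOp hΦ).adjoint ∘L featureOp hΦ) th
      lam η R where
  meas_feature := Measurable.ite
    (measurableSet_le ((hm.comp measurable_fst).norm.pow_const 2) measurable_const)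
    (hm.comp measurable_fst) measurable_const
  norm_feature := by
    intro p
    rw [truncFeature]
    split_ifs with h
    · exact h
    · simpa using hR0
  meas_label := Measurable.ite (measurable_snd measurableSet_Icc) measurable_snd measurable_const
  abs_label := by
    intro p
    rw [truncLabel]
    split_ifs with h
    · exact abs_le.2 h
    · simp
  cov := by
    intro v w
    rw [ContinuousLinearMap.comp_apply, ContinuousLinearMap.adjoint_inner_right,
      inner_featureOp_featureOp]
    have h1 : ∫ p, ⟪Φ p.1, v⟫_ℝ * ⟪Φ p.1, w⟫_ℝ ∂ρ = ∫ x, ⟪Φ x, v⟫_ℝ * ⟪Φ x, w⟫_ℝ ∂ρ.fst :=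
      (integral_map measurable_fst.aemeasurable
        ((hm.inner measurable_const).mul (hm.inner measurable_const)).aestronglyMeasurable).symm
    rw [← h1]
    refine integral_congr_ae ?_
    filter_upwards [ae_truncFeature hR] with p hp
    rw [hp]
  normal_eq := by
    intro v
    rw [ContinuousLinearMap.comp_apply, hth, ContinuousLinearMap.adjoint_inner_right,
      inner_featureOp_left]
    have h1 := integral_mul_label (ρ := ρ) (fun x => ⟪Φ x, v⟫_ℝ)
      (integrable_mul_label (hΦ.inner_const v) hY)
    have h2 : ∫ x, ⟪Φ x, v⟫_ℝ * g x ∂ρ.fst = ∫ x, ⟪Φ x, v⟫_ℝ * bayes ρ x ∂ρ.fst := by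
      refine integral_congr_ae ?_
      filter_upwards [hg] with x hx
      rw [hx]
    rw [h2, ← h1]
    refine integral_congr_ae ?_
    filter_upwards [ae_truncFeature hR, ae_truncLabel hY] with p hp hp'
    rw [← hp, ← hp', mul_comm]
  lam_pos := hlam
  step_pos := hη
  step_le := hstep

variable {H : Type*} [NormedAddCommGroup H] [InnerProductSpace ℝ H] [CompleteSpace H]
  [RKHS ℝ H X ℝ]

theorem exists_eigenbasis {F : Type*} [NormedAddCommGroup F] [InnerProductSpace ℝ F]
    [CompleteSpace F] (J : E →L[ℝ] F) :
    ∃ (n : ℕ) (u : OrthonormalBasis (Fin n) ℝ E) (τ : Fin n → ℝ),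
      ∀ j, J.adjoint (J (u j)) = τ j • u j := by
  have hsymm : ((J.adjoint ∘L J : E →L[ℝ] E) : E →ₗ[ℝ] E).IsSymmetric := by
    intro x y
    change ⟪J.adjoint (J x), y⟫_ℝ = ⟪x, J.adjoint (J y)⟫_ℝ
    rw [ContinuousLinearMap.adjoint_inner_left, ContinuousLinearMap.adjoint_inner_right]
  refine ⟨_, hsymm.eigenvectorBasis rfl, hsymm.eigenvalues rfl, fun j => ?_⟩
  exact hsymm.apply_eigenvectorBasis rfl j

theorem lintegral_sq_inner_feature (hΦ : MemLp Φ 2 ρ.fst) (v : E) :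
    ∫⁻ x, ENNReal.ofReal (⟪Φ x, v⟫_ℝ ^ 2) ∂ρ.fst = ENNReal.ofReal (‖featureOp hΦ v‖ ^ 2) := by
  rw [← ofReal_integral_eq_lintegral_ofReal (hΦ.inner_const v).integrable_sq
    (.of_forall fun x => sq_nonneg _), ← real_inner_self_eq_norm_sq, inner_featureOp_featureOp]
  simp only [pow_two]

/-- The expected squared distance in `L²` of the averaged iterates to the minimizer of the
regularized risk. -/
theorem lintegral_refASGD_sub_le (hk : ∀ x x', RKHS.kernel H x x' 1 = ⟪Φ x, Φ x'⟫_ℝ)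
    (hm : Measurable Φ) (hΦ : MemLp Φ 2 ρ.fst) (hR0 : 0 ≤ R)
    (hR : ∀ᵐ p ∂ρ, ‖Φ p.1‖ ^ 2 ≤ R) (hY : ∀ᵐ p ∂ρ, p.2 ∈ Icc (-1 : ℝ) 1)
    (hg : g =ᵐ[ρ.fst] bayes ρ)
    (hth : (featureOp hΦ).adjoint (featureOp hΦ th) + lam • th = (featureOp hΦ).adjoint g)
    (hlam : 0 < lam) (hη : 0 < η) (hstep : η * (R + lam) ≤ 1 / 2) (n : ℕ) :
    ∫⁻ z, ∫⁻ x, ENNReal.ofReal ((refASGD H η lam z n x - ⟪Φ x, th⟫_ℝ) ^ 2) ∂ρ.fst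
        ∂(Measure.infinitePi fun _ : ℕ => ρ) ≤
      ENNReal.ofReal (1 / (η ^ 2 * ((n : ℝ) + 1) ^ 2) *
          ‖resolvent (featureOp hΦ ∘L (featureOp hΦ).adjoint) lam (featureOp hΦ th)‖ ^ 2 +
        3 * (1 + R * ‖th‖ ^ 2) / ((n : ℝ) + 1) *
          trace ((featureOp hΦ ∘L (featureOp hΦ).adjoint) *
            resolvent (featureOp hΦ ∘L (featureOp hΦ).adjoint) lam)) := by
  have hd := lmsData_trunc hm hΦ hR0 hR hY hg hth hlam hη hstep
  obtain ⟨N, u, τ, hu⟩ := exists_eigenbasis (featureOp hΦ)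
  rw [norm_sq_resolvent_map u hu hlam, trace_mul_resolvent u hu hlam]
  have hae : ∀ᵐ z ∂(Measure.infinitePi fun _ : ℕ => ρ), ∀ t,
      Φ (z t).1 = truncFeature Φ R (z t) ∧ (z t).2 = truncLabel (z t) := by
    rw [ae_all_iff]
    intro t
    have h1 := measurePreserving_eval_infinitePi (fun _ : ℕ => ρ) t
    filter_upwards [h1.quasiMeasurePreserving.ae (ae_truncFeature hR),
      h1.quasiMeasurePreserving.ae (ae_truncLabel hY)] with z h2 h3
    exact ⟨h2, h3⟩
  have hinner : ∀ᵐ z ∂(Measure.infinitePi fun _ : ℕ => ρ),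
      ∫⁻ x, ENNReal.ofReal ((refASGD H η lam z n x - ⟪Φ x, th⟫_ℝ) ^ 2) ∂ρ.fst =
        ENNReal.ofReal (∑ j, τ j * ⟪u j, (1 / ((n : ℝ) + 1)) • (∑ t ∈ Finset.range (n + 1),
          lms (truncFeature Φ R) truncLabel η lam z t) - th⟫_ℝ ^ 2) := by
    filter_upwards [hae] with z hz
    simp only [refASGD_apply hk, ← inner_sub_right]
    rw [lintegral_sq_inner_feature hΦ, norm_sq_map_eq_sum u hu]
    simp only [lms_congr (Φ := fun p : X × ℝ => Φ p.1) (y := Prod.snd) hz]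
  rw [lintegral_congr_ae hinner, ← ofReal_integral_eq_lintegral_ofReal]
  · exact ENNReal.ofReal_le_ofReal (hd.integral_average_le u hu n)
  · refine (BddMeas.sum _ fun j _ => (bddMeas_const (τ j)).mul ?_).integrable _
    exact ((bddMeas_const (u j)).inner (((bddMeas_const _).smul
      (BddMeas.sum _ fun t _ => hd.bddMeas_lms t)).sub (bddMeas_const th))).sq
  · refine .of_forall fun z => Finset.sum_nonneg fun j _ => ?_
    exact mul_nonneg (eigenvalue_nonneg u hu j) (sq_nonneg _)

/-- The vector which solves the normal equations represents the unique minimizer of the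
regularized risk. -/
theorem exists_minimizer (hk : ∀ x x', RKHS.kernel H x x' 1 = ⟪Φ x, Φ x'⟫_ℝ)
    (hΦ : MemLp Φ 2 ρ.fst) (hY : ∀ᵐ p ∂ρ, p.2 ∈ Icc (-1 : ℝ) 1) (hg : g =ᵐ[ρ.fst] bayes ρ)
    (hth : (featureOp hΦ).adjoint (featureOp hΦ th) + lam • th = (featureOp hΦ).adjoint g)
    (hlam : 0 < lam) :
    ∃ m : H, (∀ x, m x = ⟪Φ x, th⟫_ℝ) ∧ ∀ h : H, h ≠ m → regRisk ρ lam m < regRisk ρ lam h := by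
  obtain ⟨m, hm, hmn⟩ := exists_of_feature hk th
  refine ⟨m, hm, fun h hne => ?_⟩
  obtain ⟨v, hv, hvn⟩ := exists_feature_repr hk h
  have hvth : v ≠ th := by
    rintro rfl
    exact hne (RKHS.ext fun x => by rw [hv, hm])
  have hrisk : ∀ (f : H) (w : E), (∀ x, f x = ⟪Φ x, w⟫_ℝ) → risk ρ f =
      1 / 2 * ‖featureOp hΦ w - g‖ ^ 2 + (1 / 2 * ∫ p, p.2 ^ 2 ∂ρ - 1 / 2 * ‖g‖ ^ 2) := by
    intro f w hf
    refine risk_eq _ _ ?_ hg hY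
    filter_upwards [featureOp_coeFn hΦ w] with x hx
    rw [hx, hf]
  have hsq := norm_sq_sub_add_eq hth v
  have hpos : 0 < ‖v - th‖ ^ 2 := pow_pos (norm_pos_iff.2 (sub_ne_zero.2 hvth)) 2
  have hm2 : ‖m‖ ^ 2 ≤ ‖th‖ ^ 2 := pow_le_pow_left₀ (norm_nonneg _) hmn 2
  rw [regRisk, regRisk, hrisk m th hm, hrisk h v hv, ← hvn]
  nlinarith [sq_nonneg ‖featureOp hΦ (v - th)‖, mul_pos hlam hpos,
    mul_le_mul_of_nonneg_left hm2 hlam.le]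

end AveragedSGD

/-! ### The neural tangent kernel -/

section Tangent

variable {d : ℕ}

/-- The contribution of a single neuron with input weights `b` to the neural tangent kernel. -/
def neuronKernel (σ : ℝ → ℝ) (γ : ℝ) (b x y : EuclideanSpace ℝ (Fin d)) : ℝ :=
  σ ⟪b, x⟫_ℝ * σ ⟪b, y⟫_ℝ +
    (⟪x, y⟫_ℝ + γ ^ 2) * (deriv σ ⟪b, x⟫_ℝ * deriv σ ⟪b, y⟫_ℝ)

/-- The gradient features of a network of width `M`: the derivatives with respect to the output
weights, the input weights and the biases, up to signs and scaled by `1 / √M`. -/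
def ntkFeature (σ : ℝ → ℝ) (γ : ℝ) {M : ℕ} (B : Fin M → EuclideanSpace ℝ (Fin d))
    (x : EuclideanSpace ℝ (Fin d)) : EuclideanSpace ℝ (Fin M ⊕ (Fin M × Fin d) ⊕ Fin M) :=
  WithLp.toLp 2 (Sum.elim (fun r => σ ⟪B r, x⟫_ℝ / √M)
    (Sum.elim (fun p => deriv σ ⟪B p.1, x⟫_ℝ * x p.2 / √M)
      (fun r => γ * deriv σ ⟪B r, x⟫_ℝ / √M)))

theorem inner_ntkFeature (σ : ℝ → ℝ) (γ : ℝ) {M : ℕ} (B : Fin M → EuclideanSpace ℝ (Fin d))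
    (x y : EuclideanSpace ℝ (Fin d)) :
    ⟪ntkFeature σ γ B x, ntkFeature σ γ B y⟫_ℝ = kFin σ γ B x y := by
  have hM : (√(M : ℝ)) * √(M : ℝ) = M := Real.mul_self_sqrt (Nat.cast_nonneg M)
  have hdiv : ∀ a b : ℝ, a / √(M : ℝ) * (b / √(M : ℝ)) = a * b / M := by
    intro a b
    rw [div_mul_div_comm, hM]
  have hxy : ⟪x, y⟫_ℝ = ∑ i, x i * y i := by
    rw [PiLp.inner_apply]
    exact Finset.sum_congr rfl fun i _ => by simp [mul_comm]
  rw [PiLp.inner_apply, kFin]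
  simp only [ntkFeature, Fintype.sum_sum_type, Fintype.sum_prod_type, Sum.elim_inl, Sum.elim_inr,
    RCLike.inner_apply, conj_trivial, hdiv]
  have h1 : ∀ r, ∑ i, deriv σ ⟪B r, y⟫_ℝ * y i * (deriv σ ⟪B r, x⟫_ℝ * x i) / (M : ℝ) =
      ⟪x, y⟫_ℝ / M * (deriv σ ⟪B r, x⟫_ℝ * deriv σ ⟪B r, y⟫_ℝ) := by
    intro r
    rw [hxy, Finset.sum_div, Finset.sum_mul]
    exact Finset.sum_congr rfl fun i _ => by ring
  simp only [h1]
  simp only [Finset.mul_sum, ← Finset.sum_add_distrib]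
  exact Finset.sum_congr rfl fun r _ => by ring

theorem continuous_ntkFeature {σ : ℝ → ℝ} (hσ : Continuous σ) (hσ' : Continuous (deriv σ))
    (γ : ℝ) {M : ℕ} (B : Fin M → EuclideanSpace ℝ (Fin d)) : Continuous (ntkFeature σ γ B) := by
  refine (PiLp.continuous_toLp 2 _).comp (continuous_pi ?_)
  rintro (r | ⟨r, i⟩ | r) <;> simp only [Sum.elim_inl, Sum.elim_inr] <;> fun_prop

theorem abs_neuronKernel_le {σ : ℝ → ℝ} (hσ' : ∀ u, |deriv σ u| ≤ 2)
    (hσ : ∀ u, |σ u| ≤ 1 + |u|) {γ : ℝ} (hγ : γ ∈ Icc (0 : ℝ) 1)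
    {b x y : EuclideanSpace ℝ (Fin d)} (hb : ‖b‖ ≤ 1) (hx : ‖x‖ ≤ 1) (hy : ‖y‖ ≤ 1) :
    |neuronKernel σ γ b x y| ≤ 12 := by
  have hin : ∀ {v w : EuclideanSpace ℝ (Fin d)}, ‖v‖ ≤ 1 → ‖w‖ ≤ 1 → |⟪v, w⟫_ℝ| ≤ 1 :=
    fun hv hw => (abs_real_inner_le_norm _ _).trans (mul_le_one₀ hv (norm_nonneg _) hw)
  have hs : ∀ {v : EuclideanSpace ℝ (Fin d)}, ‖v‖ ≤ 1 → |σ ⟪b, v⟫_ℝ| ≤ 2 := by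
    intro v hv
    linarith [hσ ⟪b, v⟫_ℝ, hin hb hv]
  have h1 : |σ ⟪b, x⟫_ℝ * σ ⟪b, y⟫_ℝ| ≤ 2 * 2 := by
    rw [abs_mul]
    exact mul_le_mul (hs hx) (hs hy) (abs_nonneg _) (by norm_num)
  have h2 : |deriv σ ⟪b, x⟫_ℝ * deriv σ ⟪b, y⟫_ℝ| ≤ 2 * 2 := by
    rw [abs_mul]
    exact mul_le_mul (hσ' _) (hσ' _) (abs_nonneg _) (by norm_num)
  have h3 : |⟪x, y⟫_ℝ + γ ^ 2| ≤ 2 := by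
    have h4 : γ ^ 2 ≤ 1 := pow_le_one₀ hγ.1 hγ.2
    have h5 := abs_add_le ⟪x, y⟫_ℝ (γ ^ 2)
    rw [abs_of_nonneg (sq_nonneg γ)] at h5
    linarith [hin hx hy]
  have h6 : |(⟪x, y⟫_ℝ + γ ^ 2) * (deriv σ ⟪b, x⟫_ℝ * deriv σ ⟪b, y⟫_ℝ)| ≤ 2 * (2 * 2) := by
    rw [abs_mul]
    exact mul_le_mul h3 h2 (abs_nonneg _) (by norm_num)
  rw [neuronKernel]
  linarith [abs_add_le (σ ⟪b, x⟫_ℝ * σ ⟪b, y⟫_ℝ)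
    ((⟪x, y⟫_ℝ + γ ^ 2) * (deriv σ ⟪b, x⟫_ℝ * deriv σ ⟪b, y⟫_ℝ))]

/-- The repetition of the weights in the symmetric initialization cancels against the width
`M = m + m`. -/
theorem kFin_symInit (σ : ℝ → ℝ) (γ : ℝ) {m : ℕ}
    (w : Fin m → Metric.sphere (0 : EuclideanSpace ℝ (Fin d)) 1)
    (x y : EuclideanSpace ℝ (Fin d)) :
    kFin σ γ (symInit w) x y = 1 / (m : ℝ) * ∑ r, neuronKernel σ γ (w r) x y := by
  have h1 : kFin σ γ (symInit w) x y =
      1 / ((m + m : ℕ) : ℝ) * ∑ r, neuronKernel σ γ (symInit w r) x y := by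
    simp only [kFin, neuronKernel, Finset.sum_add_distrib, ← Finset.mul_sum]
    ring
  rw [h1, Fin.sum_univ_add]
  simp only [symInit, Fin.append_left, Fin.append_right]
  push_cast
  rw [← two_mul, ← two_mul]
  rcases Nat.eq_zero_or_pos m with rfl | hm
  · simp
  · have : (m : ℝ) ≠ 0 := by exact_mod_cast hm.ne'
    field_simp

theorem kFin_symInit_self_le {σ : ℝ → ℝ} (hσ' : ∀ u, |deriv σ u| ≤ 2)
    (hσ : ∀ u, |σ u| ≤ 1 + |u|) {γ : ℝ} (hγ : γ ∈ Icc (0 : ℝ) 1) {m : ℕ} (hm : 0 < m)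
    (w : Fin m → Metric.sphere (0 : EuclideanSpace ℝ (Fin d)) 1)
    {x : EuclideanSpace ℝ (Fin d)} (hx : ‖x‖ ≤ 1) : kFin σ γ (symInit w) x x ≤ 12 := by
  have hm' : (0 : ℝ) < m := by exact_mod_cast hm
  have h1 : ∑ r, neuronKernel σ γ (w r) x x ≤ ∑ _r : Fin m, (12 : ℝ) :=
    Finset.sum_le_sum fun r _ => (le_abs_self _).trans
      (abs_neuronKernel_le hσ' hσ hγ (by simp) hx hx)
  rw [kFin_symInit, one_div, inv_mul_le_iff₀ hm']
  simpa using h1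

instance unifSphere_isProbabilityMeasure [NeZero d] : IsProbabilityMeasure (unifSphere d) := by
  have h0 : (volume : Measure (EuclideanSpace ℝ (Fin d))).toSphere ≠ 0 :=
    Measure.toSphere_ne_zero _
  refine ⟨?_⟩
  rw [unifSphere, Measure.smul_apply, smul_eq_mul]
  exact ENNReal.inv_mul_cancel (Measure.measure_univ_ne_zero.2 h0) (measure_ne_top _ _)

variable {X : Set (EuclideanSpace ℝ (Fin d))}

open Classical in
/-- The kernel of a single neuron, set to zero outside the unit ball. -/
def truncNeuronKernel (σ : ℝ → ℝ) (γ : ℝ) (X : Set (EuclideanSpace ℝ (Fin d)))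
    (b : Metric.sphere (0 : EuclideanSpace ℝ (Fin d)) 1) (x y : X) : ℝ :=
  if ‖(x : EuclideanSpace ℝ (Fin d))‖ ≤ 1 ∧ ‖(y : EuclideanSpace ℝ (Fin d))‖ ≤ 1 then
    neuronKernel σ γ b (x : EuclideanSpace ℝ (Fin d)) (y : EuclideanSpace ℝ (Fin d)) else 0

theorem bddMeas_truncNeuronKernel {σ : ℝ → ℝ} (hc : Continuous σ) (hc' : Continuous (deriv σ))
    (hσ' : ∀ u, |deriv σ u| ≤ 2) (hσ : ∀ u, |σ u| ≤ 1 + |u|) {γ : ℝ} (hγ : γ ∈ Icc (0 : ℝ) 1) :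
    BddMeas fun q : Metric.sphere (0 : EuclideanSpace ℝ (Fin d)) 1 × X × X =>
      truncNeuronKernel σ γ X q.1 q.2.1 q.2.2 := by
  refine ⟨?_, 12, fun q => ?_⟩
  · have h1 : MeasurableSet {q : Metric.sphere (0 : EuclideanSpace ℝ (Fin d)) 1 × X × X |
        ‖(q.2.1 : EuclideanSpace ℝ (Fin d))‖ ≤ 1} :=
      measurableSet_le (by fun_prop) measurable_const
    have h2 : MeasurableSet {q : Metric.sphere (0 : EuclideanSpace ℝ (Fin d)) 1 × X × X |
        ‖(q.2.2 : EuclideanSpace ℝ (Fin d))‖ ≤ 1} :=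
      measurableSet_le (by fun_prop) measurable_const
    unfold truncNeuronKernel neuronKernel
    exact Measurable.ite (h1.inter h2) (Continuous.measurable (by fun_prop)) measurable_const
  · simp only [truncNeuronKernel, Real.norm_eq_abs]
    split_ifs with h
    · exact abs_neuronKernel_le hσ' hσ hγ (by simp) h.1 h.2
    · simp

variable {μ : Measure X} [IsProbabilityMeasure μ]

theorem ae_prod_norm_le (hX : ∀ᵐ x : X ∂μ, ‖(x : EuclideanSpace ℝ (Fin d))‖ ≤ 1) :
    ∀ᵐ q : X × X ∂μ.prod μ, ‖(q.1 : EuclideanSpace ℝ (Fin d))‖ ≤ 1 ∧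
      ‖(q.2 : EuclideanSpace ℝ (Fin d))‖ ≤ 1 := by
  filter_upwards [Measure.quasiMeasurePreserving_fst.ae hX,
    Measure.quasiMeasurePreserving_snd.ae hX] with q h1 h2
  exact ⟨h1, h2⟩

theorem memLp_kFin_symInit {σ : ℝ → ℝ} (hc : Continuous σ) (hc' : Continuous (deriv σ))
    (hσ' : ∀ u, |deriv σ u| ≤ 2) (hσ : ∀ u, |σ u| ≤ 1 + |u|) {γ : ℝ} (hγ : γ ∈ Icc (0 : ℝ) 1)
    (hX : ∀ᵐ x : X ∂μ, ‖(x : EuclideanSpace ℝ (Fin d))‖ ≤ 1) {m : ℕ}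
    (w : Fin m → Metric.sphere (0 : EuclideanSpace ℝ (Fin d)) 1) :
    MemLp (Function.uncurry fun x x' : X => kFin σ γ (symInit w) x x') 2 (μ.prod μ) ∧
    sigmaM σ γ (symInit w) μ = integralOp μ (empKernel (truncNeuronKernel σ γ X) w) := by
  have h1 := ((bddMeas_truncNeuronKernel (X := X) hc hc' hσ' hσ hγ).empKernel w).memLp_two
    (μ.prod μ)
  have h2 : Function.uncurry (empKernel (truncNeuronKernel σ γ X) w) =ᵐ[μ.prod μ]
      Function.uncurry fun x x' : X => kFin σ γ (symInit w) x x' := by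
    filter_upwards [ae_prod_norm_le hX] with q hq
    simp only [Function.uncurry_def, kFin_symInit, empKernel, truncNeuronKernel, if_pos hq]
  exact ⟨h1.ae_eq h2, (integralOp_congr h1 h2).symm⟩

theorem sigmaInf_eq [NeZero d] {σ : ℝ → ℝ} (hc : Continuous σ) (hc' : Continuous (deriv σ))
    (hσ' : ∀ u, |deriv σ u| ≤ 2) (hσ : ∀ u, |σ u| ≤ 1 + |u|) {γ : ℝ} (hγ : γ ∈ Icc (0 : ℝ) 1)
    (hX : ∀ᵐ x : X ∂μ, ‖(x : EuclideanSpace ℝ (Fin d))‖ ≤ 1) :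
    sigmaInf σ γ μ = integralOp μ (meanKernel (unifSphere d) (truncNeuronKernel σ γ X)) := by
  have h1 := ((bddMeas_truncNeuronKernel (X := X) hc hc' hσ' hσ hγ).meanKernel
    (P := unifSphere d)).memLp_two (μ.prod μ)
  refine (integralOp_congr h1 ?_).symm
  filter_upwards [ae_prod_norm_le hX] with q hq
  have hint : ∀ f : Metric.sphere (0 : EuclideanSpace ℝ (Fin d)) 1 → ℝ, Continuous f →
      Integrable f (unifSphere d) := fun f hf =>
    hf.integrable_of_hasCompactSupport (HasCompactSupport.of_compactSpace f)
  simp only [Function.uncurry_def, kInf, meanKernel, truncNeuronKernel, if_pos hq, neuronKernel]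
  rw [integral_add (hint _ (by fun_prop)) ((hint _ (by fun_prop)).const_mul _),
    integral_const_mul]

theorem sigmaM_symInit_eq {σ : ℝ → ℝ} (hc : Continuous σ) (hc' : Continuous (deriv σ))
    (hσ' : ∀ u, |deriv σ u| ≤ 2) (hσ : ∀ u, |σ u| ≤ 1 + |u|) {γ : ℝ} (hγ : γ ∈ Icc (0 : ℝ) 1)
    (hX : ∀ᵐ x : X ∂μ, ‖(x : EuclideanSpace ℝ (Fin d))‖ ≤ 1) {m : ℕ} (hm : 0 < m)
    (w : Fin m → Metric.sphere (0 : EuclideanSpace ℝ (Fin d)) 1) :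
    ∃ hΦ : MemLp (fun x : X => ntkFeature σ γ (symInit w) x) 2 μ,
      sigmaM σ γ (symInit w) μ = featureOp hΦ ∘L (featureOp hΦ).adjoint := by
  have hΦ : MemLp (fun x : X => ntkFeature σ γ (symInit w) x) 2 μ := by
    refine MemLp.of_bound ((continuous_ntkFeature hc hc' γ (symInit w)).comp
      continuous_subtype_val).aestronglyMeasurable (√12) ?_
    filter_upwards [hX] with x hx
    refine Real.le_sqrt_of_sq_le ?_
    rw [← real_inner_self_eq_norm_sq, inner_ntkFeature]
    exact kFin_symInit_self_le hσ' hσ hγ hm w hx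
  exact ⟨hΦ, integralOp_eq_comp_adjoint (memLp_kFin_symInit hc hc' hσ' hσ hγ hX w).1 hΦ
    fun x y => (inner_ntkFeature σ γ _ _ _).symm⟩

/-- The integral operator of infinite width is symmetric and positive, as a limit of operators
of finite width. -/
theorem sigmaInf_symm_nonneg [NeZero d] {σ : ℝ → ℝ} (hc : Continuous σ)
    (hc' : Continuous (deriv σ)) (hσ' : ∀ u, |deriv σ u| ≤ 2) (hσ : ∀ u, |σ u| ≤ 1 + |u|) {γ : ℝ}
    (hγ : γ ∈ Icc (0 : ℝ) 1) (hX : ∀ᵐ x : X ∂μ, ‖(x : EuclideanSpace ℝ (Fin d))‖ ≤ 1)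
    (f g : Lp ℝ 2 μ) :
    ⟪f, sigmaInf σ γ μ g⟫_ℝ = ⟪sigmaInf σ γ μ f, g⟫_ℝ ∧ 0 ≤ ⟪f, sigmaInf σ γ μ f⟫_ℝ := by
  have hκ := bddMeas_truncNeuronKernel (X := X) hc hc' hσ' hσ hγ
  rw [sigmaInf_eq hc hc' hσ' hσ hγ hX]
  obtain ⟨w, hf, hg⟩ := exists_tendsto_emp (P := unifSphere d) (μ := μ) hκ f g
  have hJ : ∀ m : ℕ, ∃ hΦ : MemLp (fun x : X => ntkFeature σ γ (symInit (w m)) x) 2 μ,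
      integralOp μ (empKernel (truncNeuronKernel σ γ X) (w m)) =
        featureOp hΦ ∘L (featureOp hΦ).adjoint := by
    intro m
    rw [← (memLp_kFin_symInit hc hc' hσ' hσ hγ hX (w m)).2]
    exact sigmaM_symInit_eq hc hc' hσ' hσ hγ hX (Nat.succ_pos m) (w m)
  choose hΦ hJ using hJ
  constructor
  · refine tendsto_nhds_unique (tendsto_const_nhds.inner hg)
      ((hf.inner (tendsto_const_nhds (x := g))).congr fun m => ?_)
    rw [hJ]
    exact ((featureOp (hΦ m)).adjoint_inner_right ((featureOp (hΦ m)).adjoint f) g).symm.trans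
      ((featureOp (hΦ m)).adjoint_inner_left ((featureOp (hΦ m)).adjoint g) f)
  · refine ge_of_tendsto (tendsto_const_nhds.inner hf) (.of_forall fun m => ?_)
    rw [hJ]
    exact inner_comp_adjoint_nonneg _ f

/-- With high probability over the weights, the solution of the normal equations of the network
of finite width is bounded in terms of the source condition for the network of infinite width:
`f = (Σ_∞ + lam)⁻¹ g` does not depend on the weights, so the operator of finite width needs to be
close to `Σ_∞` only at the single function `f`. -/
theorem exists_event_norm_sq_normal_eq_le [NeZero d] {σ : ℝ → ℝ} (hc : Continuous σ)
    (hc' : Continuous (deriv σ)) (hσ' : ∀ u, |deriv σ u| ≤ 2) (hσ : ∀ u, |σ u| ≤ 1 + |u|) {γ : ℝ}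
    (hγ : γ ∈ Icc (0 : ℝ) 1) (hX : ∀ᵐ x : X ∂μ, ‖(x : EuclideanSpace ℝ (Fin d))‖ ≤ 1)
    {r : ℝ} (hr : r ∈ Icc (1 / 2 : ℝ) 1) (G : Lp ℝ 2 μ) {lam : ℝ} (hlam : 0 < lam) {δ : ℝ}
    (hδ : 0 < δ) :
    ∃ m₀ : ℕ, ∀ m : ℕ, m₀ ≤ m → 0 < m →
      ∃ Ev : Set (Fin m → Metric.sphere (0 : EuclideanSpace ℝ (Fin d)) 1), MeasurableSet Ev ∧
        ENNReal.ofReal (1 - δ) ≤ Measure.pi (fun _ : Fin m => unifSphere d) Ev ∧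
        ∀ w ∈ Ev, ∀ (hΦ : MemLp (fun x : X => ntkFeature σ γ (symInit w) x) 2 μ)
          (th : EuclideanSpace ℝ (Fin (m + m) ⊕ (Fin (m + m) × Fin d) ⊕ Fin (m + m))),
          (featureOp hΦ).adjoint (featureOp hΦ th) + lam • th =
            (featureOp hΦ).adjoint (opPow (sigmaInf σ γ μ) r G) →
          ‖th‖ ^ 2 ≤ 1 / 9 * ‖opPow (sigmaInf σ γ μ) r G‖ ^ 2 + 9 / 4 * ‖G‖ ^ 2 + 5 / 36 := by
  set S := sigmaInf σ γ μ with hS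
  set g : Lp ℝ 2 μ := opPow S r G with hg
  have hpos : ∀ f, 0 ≤ ⟪f, S f⟫_ℝ := fun f =>
    (sigmaInf_symm_nonneg hc hc' hσ' hσ hγ hX f f).2
  have hsymm : ∀ f g, ⟪f, S g⟫_ℝ = ⟪S f, g⟫_ℝ := fun f g =>
    (sigmaInf_symm_nonneg hc hc' hσ' hσ hγ hX f g).1
  set f := resolvent S lam g with hf
  have hfeq : S f + lam • f = g := add_resolvent_apply hpos hlam g
  have hfle : ⟪f, g⟫_ℝ ≤ 1 / 9 * ‖g‖ ^ 2 + 9 / 4 * ‖G‖ ^ 2 :=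
    inner_le_of_opPow hpos hsymm hlam hr G f hfeq
  -- `ε` is small enough for an error of `5 / 36` in the squared norm of the minimizer
  set K := 1 / lam + ‖f‖ with hK
  have hK0 : 0 < K := by positivity
  set ε := min 1 (5 / 36 / K) with hε
  have hε0 : 0 < ε := lt_min one_pos (by positivity)
  have hεK : 1 / lam * ε ^ 2 + ε * ‖f‖ ≤ 5 / 36 := by
    have h1 : ε * K ≤ 5 / 36 := by
      rw [← le_div_iff₀ hK0]
      exact min_le_right _ _
    have h2 : 1 / lam * ε ^ 2 ≤ 1 / lam * ε :=
      mul_le_mul_of_nonneg_left (by nlinarith [min_le_left 1 (5 / 36 / K)]) (by positivity)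
    rw [hK, mul_add] at h1
    linarith
  obtain ⟨m₀, hm₀⟩ := exists_event_norm_emp_sub_mean_le (P := unifSphere d) (μ := μ)
    (bddMeas_truncNeuronKernel (X := X) hc hc' hσ' hσ hγ) f hε0 hδ
  refine ⟨m₀, fun m hm hm0 => ?_⟩
  obtain ⟨Ev, hEvm, hEvp, hEv⟩ := hm₀ m hm hm0
  refine ⟨Ev, hEvm, hEvp, fun w hw hΦ th hth => ?_⟩
  have hdev := hEv w hw
  rw [← sigmaInf_eq hc hc' hσ' hσ hγ hX, ← (memLp_kFin_symInit hc hc' hσ' hσ hγ hX w).2,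
    (sigmaM_symInit_eq hc hc' hσ' hσ hγ hX hm0 w).choose_spec] at hdev
  have h1 := norm_sq_normal_eq_le hlam hth hfeq
  set D := ‖featureOp hΦ ((featureOp hΦ).adjoint f) - S f‖ with hD
  have h2 : D ≤ ε := hdev
  have h3 : 1 / lam * D ^ 2 ≤ 1 / lam * ε ^ 2 := mul_le_mul_of_nonneg_left
    (pow_le_pow_left₀ (norm_nonneg _) h2 2) (by positivity)
  have h4 := mul_le_mul_of_nonneg_right h2 (norm_nonneg f)
  linarith

end Tangent

end

end NTK

/-! ### The convergence rate for the neural tangent kernel -/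

theorem theoremA {d : ℕ} (hd : 0 < d)
    -- the feature space `X ⊆ ℝᵈ` and the data distribution
    {X : Set (EuclideanSpace ℝ (Fin d))} (hX : MeasurableSet X)
    (ρ : Measure (X × ℝ)) [IsProbabilityMeasure ρ]
    -- the activation function
    (σ : ℝ → ℝ) (hσ : Differentiable ℝ σ) (hσ' : Differentiable ℝ (deriv σ))
    (hA1 : ∃ C : ℝ, 0 < C ∧ ∀ u, |deriv (deriv σ) u| ≤ C)
    (hA1' : ∀ u, |deriv σ u| ≤ 2) (hA1'' : ∀ u, |σ u| ≤ 1 + |u|)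
    -- boundedness of the features, of the labels and of the scale of the biases
    (hA2X : ∀ᵐ p ∂ρ, ‖(p.1 : EuclideanSpace ℝ (Fin d))‖ ≤ 1)
    (hA2Y : ∀ᵐ p ∂ρ, p.2 ∈ Icc (-1 : ℝ) 1)
    (γ : ℝ) (hγ : γ ∈ Icc (0 : ℝ) 1)
    -- the source condition, with `G` in the role of `Σ_∞^{-r} g_ρ`
    (r : ℝ) (hr : r ∈ Icc (1 / 2 : ℝ) 1) (G : Lp ℝ 2 ρ.fst)
    (hA3 : (NTK.opPow (NTK.sigmaInf σ γ ρ.fst) r G : Lp ℝ 2 ρ.fst) =ᵐ[ρ.fst] NTK.bayes ρ)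
    (lam : ℝ) (hlam : 0 < lam) (δ : ℝ) (hδ : δ ∈ Ioo (0 : ℝ) 1) :
    ∃ M₀ : ℕ, 0 < M₀ ∧ ∀ m : ℕ, M₀ ≤ m + m →
      -- an event of probability at least `1 - δ` for the `m` independent initial weights
      ∃ Ev : Set (Fin m → Metric.sphere (0 : EuclideanSpace ℝ (Fin d)) 1), MeasurableSet Ev ∧
        ENNReal.ofReal (1 - δ) ≤ Measure.pi (fun _ : Fin m => NTK.unifSphere d) Ev ∧
        ∀ w ∈ Ev,
          -- the minimizer `g` of the regularized risk over `H_M`, where `M = m + m`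
          ∃ g : NTK.HM σ γ (NTK.symInit w) X,
            (∀ h : NTK.HM σ γ (NTK.symInit w) X, h ≠ g →
              NTK.regRisk ρ lam g < NTK.regRisk ρ lam h) ∧
            ∀ (η : ℝ) (T : ℕ), 0 < η → 4 * (6 + lam) * η ≤ 1 →
              let SM := NTK.sigmaM σ γ (NTK.symInit w) ρ.fst
              let g₂ := NTK.toL2 ρ.fst g
              ∫⁻ z, ∫⁻ x, ENNReal.ofReal
                  ((NTK.refASGD (NTK.HM σ γ (NTK.symInit w) X) η lam z T x - g x) ^ 2)
                  ∂ρ.fst ∂(Measure.infinitePi fun _ : ℕ => ρ)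
                ≤ ENNReal.ofReal
                  (4 / (η ^ 2 * ((T : ℝ) + 1) ^ 2) * ‖NTK.resolvent SM lam g₂‖ ^ 2
                  + 2 * 24 ^ 2 / ((T : ℝ) + 1)
                    * ‖NTK.opPow (SM + lam • 1) (-1 / 2) g₂‖ ^ 2
                  + 8 / ((T : ℝ) + 1)
                    * (1 + (∫ x, NTK.bayes ρ x ^ 2 ∂ρ.fst) + 24 * ‖G‖ ^ 2)
                    * NTK.trace (SM * NTK.resolvent SM lam)) := by
  have : NeZero d := ⟨hd.ne'⟩
  have hc : Continuous σ := hσ.continuous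
  have hc' : Continuous (deriv σ) := hσ'.continuous
  have hXμ : ∀ᵐ x : X ∂ρ.fst, ‖(x : EuclideanSpace ℝ (Fin d))‖ ≤ 1 := by
    have hms : MeasurableSet {x : X | ‖(x : EuclideanSpace ℝ (Fin d))‖ ≤ 1} :=
      measurableSet_le (by fun_prop) measurable_const
    exact (ae_map_iff measurable_fst.aemeasurable hms).2 hA2X
  set gρ : Lp ℝ 2 ρ.fst := NTK.opPow (NTK.sigmaInf σ γ ρ.fst) r G with hgρ
  obtain ⟨m₀, hm₀⟩ := NTK.exists_event_norm_sq_normal_eq_le (μ := ρ.fst) hc hc' hA1' hA1'' hγ hXμ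
    hr G hlam hδ.1
  refine ⟨2 * m₀ + 1, by omega, fun m hm => ?_⟩
  have hm0 : 0 < m := by omega
  obtain ⟨Ev, hEvm, hEvp, hEv⟩ := hm₀ m (by omega) hm0
  refine ⟨Ev, hEvm, hEvp, fun w hw => ?_⟩
  obtain ⟨hΦ, hSM⟩ := NTK.sigmaM_symInit_eq hc hc' hA1' hA1'' hγ hXμ hm0 w
  obtain ⟨th, hth⟩ := NTK.exists_normal_eq (NTK.featureOp hΦ) hlam gρ
  have hthn : ‖th‖ ^ 2 ≤ 1 / 9 * ‖gρ‖ ^ 2 + 9 / 4 * ‖G‖ ^ 2 + 5 / 36 := hEv w hw hΦ th hth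
  have hk : ∀ x x' : X, RKHS.kernel (NTK.HM σ γ (NTK.symInit w) X) x x' 1 =
      ⟪NTK.ntkFeature σ γ (NTK.symInit w) x, NTK.ntkFeature σ γ (NTK.symInit w) x'⟫_ℝ := by
    intro x x'
    rw [RKHS.OfKernel.kernel_ofKernel, NTK.inner_ntkFeature]
    simp [NTK.kernelMatrix]
  obtain ⟨g, hg, hmin⟩ := NTK.exists_minimizer hk hΦ hA2Y hA3 hth hlam
  refine ⟨g, hmin, fun η T hη hstep => ?_⟩
  intro SM g₂
  have hSM' : SM = NTK.featureOp hΦ ∘L (NTK.featureOp hΦ).adjoint := hSM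
  have hg₂ : g₂ = NTK.featureOp hΦ th := NTK.toL2_eq_featureOp hΦ th hg
  have hmeas : Measurable fun x : X => NTK.ntkFeature σ γ (NTK.symInit w) x :=
    ((NTK.continuous_ntkFeature hc hc' γ (NTK.symInit w)).comp continuous_subtype_val).measurable
  have hR : ∀ᵐ p ∂ρ, ‖NTK.ntkFeature σ γ (NTK.symInit w) p.1‖ ^ 2 ≤ 12 := by
    filter_upwards [hA2X] with p hp
    rw [← real_inner_self_eq_norm_sq, NTK.inner_ntkFeature]
    exact NTK.kFin_symInit_self_le hA1' hA1'' hγ hm0 w hp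
  have hstep' : η * (12 + lam) ≤ 1 / 2 := by nlinarith [mul_pos hη hlam]
  have hmain := NTK.lintegral_refASGD_sub_le hk hmeas hΦ (by norm_num) hR hA2Y hA3 hth hlam hη
    hstep' T
  simp only [← hg, ← hSM', ← hg₂] at hmain
  refine hmain.trans (ENNReal.ofReal_le_ofReal ?_)
  have htr : 0 ≤ NTK.trace (SM * NTK.resolvent SM lam) := by
    obtain ⟨n, u, τ, hu⟩ := NTK.exists_eigenbasis (NTK.featureOp hΦ)
    rw [hSM', NTK.trace_mul_resolvent u hu hlam]
    refine Finset.sum_nonneg fun j _ => ?_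
    have := NTK.eigenvalue_nonneg u hu j
    positivity
  have hbayes : ∫ x, NTK.bayes ρ x ^ 2 ∂ρ.fst = ‖gρ‖ ^ 2 := by
    rw [← real_inner_self_eq_norm_sq, L2.inner_def]
    refine integral_congr_ae ?_
    filter_upwards [hA3] with x hx
    simp only [hx]
    simp [pow_two]
  rw [hbayes]
  have hT : (0 : ℝ) < (T : ℝ) + 1 := by positivity
  -- `3 + 36 ‖th‖² ≤ 8 + 4 ‖gρ‖² + 81 ‖G‖²`
  have hcoef : 3 * (1 + 12 * ‖th‖ ^ 2) / ((T : ℝ) + 1) ≤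
      8 / ((T : ℝ) + 1) * (1 + ‖gρ‖ ^ 2 + 24 * ‖G‖ ^ 2) := by
    rw [div_mul_eq_mul_div]
    refine div_le_div_of_nonneg_right ?_ hT.le
    nlinarith [sq_nonneg ‖gρ‖, sq_nonneg ‖G‖]
  have hbias : 1 / (η ^ 2 * ((T : ℝ) + 1) ^ 2) * ‖NTK.resolvent SM lam g₂‖ ^ 2 ≤
      4 / (η ^ 2 * ((T : ℝ) + 1) ^ 2) * ‖NTK.resolvent SM lam g₂‖ ^ 2 := by
    gcongr
    norm_num
  have hmid : 0 ≤ 2 * 24 ^ 2 / ((T : ℝ) + 1) *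
      ‖NTK.opPow (SM + lam • 1) (-1 / 2) g₂‖ ^ 2 := by positivity
  have hvar := mul_le_mul_of_nonneg_right hcoef htr
  linarith
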